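/- **Theorem (main colax adjunction theorem).** Let $(D,y)$ be a left Kan pseudomonad on a 2-category $\mathcal K$: a function $D$ on objects, 1-cells $y_A\colon A\to DA$, and for each 1-cell $f\colon A\to DB$ a left Kan extension $f^{\mathbb D}\colon DA\to DB$ of $f$ along $y_A$ with invertible 2-cell $\mathbb D_f\colon f\Rightarrow f^{\mathbb D}y_A$, such that $1_{y_A}$ exhibits $1_{DA}$ as a left Kan extension of $y_A$ along $y_A$, and every $g^{\mathbb D}$ (for $g\colon B\to DC$) preserves the left Kan extension $(f^{\mathbb D},\mathbb D_f)$. A pseudo-$D$-algebra is an object $C$ with, for each $f\colon B\to C$, a left Kan extension $(f^{\mathbb C},\mathbb C_f)$ of $f$ along $y_B$ with $\mathbb C_f$ invertible, such that every $g^{\mathbb C}$ (for $g\colon B\to C$) preserves the extensions $(f^{\mathbb D},\mathbb D_f)$, $f\colon A\to DB$; a pseudomorphism of algebras is a 1-cell preserving the chosen extensions of its source, and 2-cells are all 2-cells of $\mathcal K$. Let $\mathcal K_D$ be the full sub-2-category of pseudo-$D$-algebras on the free algebras $(DA,(-)^{\mathbb D})$, and let $J_D\colon\mathcal K\to\mathcal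 K_D$ be the pseudofunctor with $J_DA=DA$, $J_Df=(y_Bf)^{\mathbb D}$ for $f\colon A\to B$, and 2-cell action and coherence isomorphisms induced by the universal property of left Kan extensions. A colax adjunction with left colax adjoint $F\colon\mathcal C\to\mathcal E$ and right colax adjoint $U\colon\mathcal E\to\mathcal C$ ($F,U$ pseudofunctors) consists of colax natural transformations $\eta\colon 1\Rightarrow UF$ and $\epsilon\colon FU\Rightarrow 1$ (with 2-cells $\eta_f\colon\eta_B\circ f\Rightarrow UFf\circ\eta_A$, and likewise for $\epsilon$) and modifications $\Psi\colon\epsilon F\circ F\eta\to 1_F$ and $\Phi\colon 1_U\to U\epsilon\circ\eta U$ satisfying the two swallowtail identities; it is a biadjunction if $\eta,\epsilon$ are pseudonatural and $\Psi,\Phi$ are invertible. Let $\mathcal L$ be a 2-category, $G\colon\mathcal K_D\to\mathcal L$ and $H\colon\mathcal L\to\mathcal K$ pseudofunctors, and suppose given a biadjunction with left biadjoint $G\circ J_D\colon\mathcal K\to\mathcal L$, right biadjoint $H$ and counit $s\colon GJ_DH\Rightarrow 1_{\mathcal L}$. Then there is a colax adjunction with left colax adjoint $G\colon\mathcal K_D\to\mathcal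 L$, right colax adjoint $J_D\circ H\colon\mathcal L\to\mathcal K_D$, and the same counit $s$. -/

import Mathlib

open CategoryTheory Bicategory

universe w v u w₁ v₁ u₁ w₂ v₂ u₂

namespace CategoryTheory

/-! ## Left Kan extensions in a bicategory -/

section Kan

variable {B : Type u} [Bicategory.{w, v} B] {a b c d e : B} {f : a ⟶ b} {g g' : a ⟶ c}
  {k k' : b ⟶ c}

/-- The 2-cell `η : g ⟶ f ≫ k` exhibits `k` as a left Kan extension of `g` along `f`. -/
def IsLeftKan (f : a ⟶ b) (g : a ⟶ c) (k : b ⟶ c) (η : g ⟶ f ≫ k) : Prop :=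
  Nonempty (LeftExtension.mk (f := f) k η).IsKan

/-- The 1-cell `h` preserves the extension `η : g ⟶ f ≫ k`, that is, the whiskered 2-cell
exhibits `k ≫ h` as a left Kan extension of `g ≫ h` along `f`. -/
def PreservesLeftKan (f : a ⟶ b) (g : a ⟶ c) (k : b ⟶ c) (η : g ⟶ f ≫ k) (h : c ⟶ d) : Prop :=
  IsLeftKan f (g ≫ h) (k ≫ h) (η ▷ h ≫ (α_ f k h).hom)

namespace IsLeftKan

theorem mk' {η : g ⟶ f ≫ k}
    (h : ∀ (l : b ⟶ c) (β : g ⟶ f ≫ l), ∃! τ : k ⟶ l, η ≫ f ◁ τ = β) :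
    IsLeftKan f g k η :=
  ⟨.mk (fun s ↦ LeftExtension.homMk (h s.extension s.unit).choose
      (h s.extension s.unit).choose_spec.1) (fun s τ ↦ by
    ext
    exact (h s.extension s.unit).choose_spec.2 _ (LeftExtension.w τ))⟩

/-- The 2-cell out of a left Kan extension induced by its universal property. -/
noncomputable def desc {η : g ⟶ f ≫ k} (hη : IsLeftKan f g k η) {l : b ⟶ c}
    (β : g ⟶ f ≫ l) : k ⟶ l :=
  hη.some.desc (.mk l β)

@[simp]
theorem fac {η : g ⟶ f ≫ k} (hη : IsLeftKan f g k η) {l : b ⟶ c} (β : g ⟶ f ≫ l) :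
    η ≫ f ◁ hη.desc β = β :=
  hη.some.fac (.mk l β)

@[simp]
theorem fac_assoc {η : g ⟶ f ≫ k} (hη : IsLeftKan f g k η) {l : b ⟶ c} (β : g ⟶ f ≫ l)
    {m : a ⟶ c} (ρ : f ≫ l ⟶ m) : η ≫ f ◁ hη.desc β ≫ ρ = β ≫ ρ := by
  rw [← Category.assoc, fac]

theorem hom_ext {η : g ⟶ f ≫ k} (hη : IsLeftKan f g k η) {l : b ⟶ c} {τ τ' : k ⟶ l}
    (w : η ≫ f ◁ τ = η ≫ f ◁ τ') : τ = τ' :=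
  LeftExtension.IsKan.hom_ext hη.some w

/-- The canonical isomorphism between two left Kan extensions of the same 1-cell. -/
@[simps]
noncomputable def iso {η : g ⟶ f ≫ k} {η' : g ⟶ f ≫ k'} (hη : IsLeftKan f g k η)
    (hη' : IsLeftKan f g k' η') : k ≅ k' where
  hom := hη.desc η'
  inv := hη'.desc η
  hom_inv_id := hη.hom_ext (by simp)
  inv_hom_id := hη'.hom_ext (by simp)

theorem ofIso {η : g ⟶ f ≫ k} (hη : IsLeftKan f g k η) (i : k ≅ k') (e : g' ≅ g) :
    IsLeftKan f g' k' (e.hom ≫ η ≫ f ◁ i.hom) :=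
  mk' fun l β ↦ ⟨i.inv ≫ hη.desc (e.inv ≫ β), by simp, fun τ hτ ↦ by
    rw [Iso.eq_inv_comp]
    refine hη.hom_ext ?_
    rw [fac, Iso.eq_inv_comp]
    simpa using hτ⟩

end IsLeftKan

namespace PreservesLeftKan

variable {η : g ⟶ f ≫ k}

theorem id (hη : IsLeftKan f g k η) : PreservesLeftKan f g k η (𝟙 c) := by
  have := hη.ofIso (ρ_ k).symm (ρ_ g)
  refine cast ?_ this
  congr 1
  simp

theorem ofIso {h : c ⟶ d} (hh : PreservesLeftKan f g k η h) (i : k ≅ k') :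
    PreservesLeftKan f g k' (η ≫ f ◁ i.hom) h := by
  have := IsLeftKan.ofIso hh (whiskerRightIso i h) (Iso.refl _)
  refine cast ?_ this
  unfold PreservesLeftKan
  congr 1
  simp

theorem comp {h : c ⟶ d} {l : d ⟶ e}
    (hl : PreservesLeftKan f (g ≫ h) (k ≫ h) (η ▷ h ≫ (α_ f k h).hom) l) :
    PreservesLeftKan f g k η (h ≫ l) := by
  have := IsLeftKan.ofIso hl (α_ k h l) (α_ g h l).symm
  refine cast ?_ this
  unfold PreservesLeftKan
  congr 1
  simp

end PreservesLeftKan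

end Kan

/-! ## Left Kan pseudomonads, their algebras and the Kleisli 2-category -/

/-- A left Kan pseudomonad `(D, y)`. -/
structure LeftKanPseudomonad (K : Type u) [Bicategory.{w, v} K] where
  /-- the action on objects -/
  D : K → K
  /-- the unit -/
  y (A : K) : A ⟶ D A
  /-- the extension of `f : A ⟶ D B` along `y A` -/
  ext {A B : K} (f : A ⟶ D B) : D A ⟶ D B
  /-- the 2-cell accompanying the extension -/
  cell {A B : K} (f : A ⟶ D B) : f ≅ y A ≫ ext f
  isLeftKan {A B : K} (f : A ⟶ D B) : IsLeftKan (y A) f (ext f) (cell f).hom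
  isLeftKan_id (A : K) : IsLeftKan (y A) (y A) (𝟙 (D A)) (ρ_ (y A)).inv
  preserves {A B C : K} (f : A ⟶ D B) (g : B ⟶ D C) :
    PreservesLeftKan (y A) f (ext f) (cell f).hom (ext g)

namespace LeftKanPseudomonad

variable {K : Type u} [Bicategory.{w, v} K] (T : LeftKanPseudomonad K)

/-- A pseudo-`D`-algebra. -/
structure PsAlg where
  /-- the underlying object -/
  carrier : K
  /-- the extension of `f : B ⟶ carrier` along `y B` -/
  ext {B : K} (f : B ⟶ carrier) : T.D B ⟶ carrier
  /-- the 2-cell accompanying the extension -/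
  cell {B : K} (f : B ⟶ carrier) : f ≅ T.y B ≫ ext f
  isLeftKan {B : K} (f : B ⟶ carrier) : IsLeftKan (T.y B) f (ext f) (cell f).hom
  preserves {A B : K} (f : A ⟶ T.D B) (g : B ⟶ carrier) :
    PreservesLeftKan (T.y A) f (T.ext f) (T.cell f).hom (ext g)

namespace PsAlg

variable {T}

/-- A `D`-pseudomorphism: a 1-cell that preserves the chosen Kan extensions of the source. -/
@[ext]
structure Hom (X Y : T.PsAlg) where
  /-- the underlying 1-cell -/
  hom : X.carrier ⟶ Y.carrier
  preserves {B : K} (f : B ⟶ X.carrier) :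
    PreservesLeftKan (T.y B) f (X.ext f) (X.cell f).hom hom

@[simps id_hom comp_hom]
instance categoryStruct : CategoryStruct T.PsAlg where
  Hom := Hom
  id X := ⟨𝟙 X.carrier, fun f ↦ .id (X.isLeftKan f)⟩
  comp {X Y Z} h l := ⟨h.hom ≫ l.hom, fun {B} f ↦ .comp (by
    have hf : IsLeftKan (T.y B) (f ≫ h.hom) (X.ext f ≫ h.hom) _ := h.preserves f
    have := (l.preserves (f ≫ h.hom)).ofIso ((Y.isLeftKan (f ≫ h.hom)).iso hf)
    rwa [IsLeftKan.iso_hom, IsLeftKan.fac] at this)⟩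

/-- A 2-cell between `D`-pseudomorphisms is a 2-cell between the underlying 1-cells. -/
@[ext]
structure Hom₂ {X Y : T.PsAlg} (h l : X ⟶ Y) where
  /-- the underlying 2-cell -/
  cell : h.hom ⟶ l.hom

@[simps id_cell comp_cell]
instance homCategory (X Y : T.PsAlg) : Category (X ⟶ Y) where
  Hom h l := Hom₂ h l
  id h := ⟨𝟙 h.hom⟩
  comp σ τ := ⟨σ.cell ≫ τ.cell⟩

@[ext]
theorem hom₂_ext {X Y : T.PsAlg} {h l : X ⟶ Y} {σ τ : h ⟶ l} (e : σ.cell = τ.cell) : σ = τ :=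
  Hom₂.ext e

@[ext]
theorem hom_ext {X Y : T.PsAlg} {h l : X ⟶ Y} (e : h.hom = l.hom) : h = l :=
  Hom.ext e

/-- An invertible 2-cell between underlying 1-cells is an invertible 2-cell of algebras. -/
@[simps]
def isoMk {X Y : T.PsAlg} {h l : X ⟶ Y} (i : h.hom ≅ l.hom) : h ≅ l where
  hom := ⟨i.hom⟩
  inv := ⟨i.inv⟩

/-- The 2-category `Ps-D-Alg`. -/
@[simps whiskerLeft_cell whiskerRight_cell associator leftUnitor rightUnitor]
instance bicategory : Bicategory T.PsAlg where
  whiskerLeft {_ _ _} h {l l'} τ := (⟨h.hom ◁ Hom₂.cell τ⟩ : Hom₂ (h ≫ l) (h ≫ l'))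
  whiskerRight {_ _ _ h h'} τ l := (⟨Hom₂.cell τ ▷ l.hom⟩ : Hom₂ (h ≫ l) (h' ≫ l))
  associator h l m := isoMk (h := (h ≫ l) ≫ m) (l := h ≫ l ≫ m) (α_ h.hom l.hom m.hom)
  leftUnitor {X _} h := isoMk (h := 𝟙 X ≫ h) (l := h) (λ_ h.hom)
  rightUnitor {_ Y} h := isoMk (h := h ≫ 𝟙 Y) (l := h) (ρ_ h.hom)
  whisker_exchange σ τ := by ext; simpa using whisker_exchange _ _

theorem eqToHom_cell {X Y : T.PsAlg} {h l : X ⟶ Y} (e : h = l) :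
    (eqToHom e).cell = eqToHom (congrArg Hom.hom e) := by
  subst e; rfl

instance strict [Strict K] : Strict T.PsAlg where
  id_comp f := hom_ext (Strict.id_comp f.hom)
  comp_id f := hom_ext (Strict.comp_id f.hom)
  assoc f g h := hom_ext (Strict.assoc f.hom g.hom h.hom)
  leftUnitor_eqToIso f := by
    ext; simp [eqToHom_cell, Strict.leftUnitor_eqToIso]
  rightUnitor_eqToIso f := by
    ext; simp [eqToHom_cell, Strict.rightUnitor_eqToIso]
  associator_eqToIso f g h := by
    ext; simp [eqToHom_cell, Strict.associator_eqToIso]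

end PsAlg

/-- The free algebra on `A`. -/
def free (A : K) : T.PsAlg where
  carrier := T.D A
  ext := T.ext
  cell := T.cell
  isLeftKan := T.isLeftKan
  preserves := T.preserves

/-- The objects of the Kleisli 2-category: the free algebras. -/
structure FreeAlg where
  /-- the underlying algebra -/
  alg : T.PsAlg
  isFree : ∃ A : K, alg = T.free A

/-- The Kleisli 2-category: the full sub-2-category of `Ps-D-Alg` spanned by the free algebras. -/
abbrev Kleisli := InducedBicategory T.PsAlg (FreeAlg.alg (T := T))

/-- The action of `D` on 1-cells, `D f = (f ≫ y)^D`. -/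
def map {A B : K} (f : A ⟶ B) : T.D A ⟶ T.D B := T.ext (f ≫ T.y B)

/-- The naturality square of the unit at `f`. -/
def sq {A B : K} (f : A ⟶ B) : f ≫ T.y B ≅ T.y A ≫ T.map f := T.cell (f ≫ T.y B)

theorem isLeftKan_sq {A B : K} (f : A ⟶ B) :
    IsLeftKan (T.y A) (f ≫ T.y B) (T.map f) (T.sq f).hom :=
  T.isLeftKan _

/-- The action of `D` on 2-cells: `D σ` is the unique 2-cell compatible with the naturality squares
of the unit. -/
noncomputable def map₂ {A B : K} {f g : A ⟶ B} (σ : f ⟶ g) : T.map f ⟶ T.map g :=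
  (T.isLeftKan_sq f).desc (σ ▷ T.y B ≫ (T.sq g).hom)

theorem sq_map₂ {A B : K} {f g : A ⟶ B} (σ : f ⟶ g) :
    (T.sq f).hom ≫ T.y A ◁ T.map₂ σ = σ ▷ T.y B ≫ (T.sq g).hom :=
  IsLeftKan.fac _ _

theorem sq_map₂_assoc {A B : K} {f g : A ⟶ B} (σ : f ⟶ g) {k : A ⟶ T.D B}
    (ρ : T.y A ≫ T.map g ⟶ k) :
    (T.sq f).hom ≫ T.y A ◁ T.map₂ σ ≫ ρ = σ ▷ T.y B ≫ (T.sq g).hom ≫ ρ := by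
  rw [← Category.assoc, sq_map₂, Category.assoc]

theorem isLeftKan_mapId (A : K) :
    IsLeftKan (T.y A) (𝟙 A ≫ T.y A) (𝟙 (T.D A)) ((λ_ (T.y A)).hom ≫ (ρ_ (T.y A)).inv) := by
  simpa using (T.isLeftKan_id A).ofIso (Iso.refl _) (λ_ (T.y A))

/-- The comparison `D 1 ≅ 1`: both sides are left Kan extensions of `y` along `y`. -/
noncomputable def mapId (A : K) : T.map (𝟙 A) ≅ 𝟙 (T.D A) :=
  (T.isLeftKan_sq (𝟙 A)).iso (T.isLeftKan_mapId A)

theorem sq_mapId (A : K) :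
    (T.sq (𝟙 A)).hom ≫ T.y A ◁ (T.mapId A).hom = (λ_ (T.y A)).hom ≫ (ρ_ (T.y A)).inv :=
  IsLeftKan.fac _ _

/-- The pasting of the naturality squares of the unit at `f` and at `g`. -/
def sqComp {A B C : K} (f : A ⟶ B) (g : B ⟶ C) :
    (f ≫ g) ≫ T.y C ⟶ T.y A ≫ T.map f ≫ T.map g :=
  (α_ _ _ _).hom ≫ f ◁ (T.sq g).hom ≫ (α_ _ _ _).inv ≫ (T.sq f).hom ▷ T.map g ≫ (α_ _ _ _).hom

theorem isLeftKan_sqComp {A B C : K} (f : A ⟶ B) (g : B ⟶ C) :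
    IsLeftKan (T.y A) ((f ≫ g) ≫ T.y C) (T.map f ≫ T.map g) (T.sqComp f g) := by
  have h : IsLeftKan (T.y A) ((f ≫ T.y B) ≫ T.map g) (T.map f ≫ T.map g)
      ((T.sq f).hom ▷ T.map g ≫ (α_ _ _ _).hom) := T.preserves (f ≫ T.y B) (g ≫ T.y C)
  simpa [sqComp] using h.ofIso (Iso.refl _)
    (α_ _ _ _ ≪≫ whiskerLeftIso f (T.sq g) ≪≫ (α_ _ _ _).symm)

/-- The comparison `D (f ≫ g) ≅ D f ≫ D g`: both sides are left Kan extensions of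
`(f ≫ g) ≫ y` along `y`. -/
noncomputable def mapComp {A B C : K} (f : A ⟶ B) (g : B ⟶ C) :
    T.map (f ≫ g) ≅ T.map f ≫ T.map g :=
  (T.isLeftKan_sq (f ≫ g)).iso (T.isLeftKan_sqComp f g)

theorem sq_mapComp {A B C : K} (f : A ⟶ B) (g : B ⟶ C) :
    (T.sq (f ≫ g)).hom ≫ T.y A ◁ (T.mapComp f g).hom = T.sqComp f g :=
  IsLeftKan.fac _ _

theorem sq_mapComp_assoc {A B C : K} (f : A ⟶ B) (g : B ⟶ C) {k : A ⟶ T.D C}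
    (ρ : T.y A ≫ T.map f ≫ T.map g ⟶ k) :
    (T.sq (f ≫ g)).hom ≫ T.y A ◁ (T.mapComp f g).hom ≫ ρ = T.sqComp f g ≫ ρ := by
  rw [← Category.assoc, sq_mapComp]

theorem map₂_id {A B : K} (f : A ⟶ B) : T.map₂ (𝟙 f) = 𝟙 (T.map f) :=
  (T.isLeftKan_sq f).hom_ext (by simp [sq_map₂])

theorem map₂_comp {A B : K} {f g h : A ⟶ B} (σ : f ⟶ g) (τ : g ⟶ h) :
    T.map₂ (σ ≫ τ) = T.map₂ σ ≫ T.map₂ τ :=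
  (T.isLeftKan_sq f).hom_ext (by simp [sq_map₂, sq_map₂_assoc])

theorem map₂_whiskerLeft {A B C : K} (f : A ⟶ B) {g h : B ⟶ C} (σ : g ⟶ h) :
    T.map₂ (f ◁ σ) ≫ (T.mapComp f h).hom = (T.mapComp f g).hom ≫ T.map f ◁ T.map₂ σ :=
  (T.isLeftKan_sq (f ≫ g)).hom_ext (by
    simp only [whiskerLeft_comp, sq_map₂_assoc, sq_mapComp, sq_mapComp_assoc, sqComp]
    calc
      _ = 𝟙 _ ⊗≫ f ◁ (σ ▷ T.y C ≫ (T.sq h).hom) ⊗≫ (T.sq f).hom ▷ T.map h ⊗≫ 𝟙 _ := by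
        bicategory
      _ = 𝟙 _ ⊗≫ f ◁ (T.sq g).hom ⊗≫ ((f ≫ T.y B) ◁ T.map₂ σ ≫ (T.sq f).hom ▷ T.map h) ⊗≫ 𝟙 _ := by
        rw [← sq_map₂]
        bicategory
      _ = _ := by
        rw [whisker_exchange]
        bicategory)

theorem map₂_whiskerRight {A B C : K} {f g : A ⟶ B} (σ : f ⟶ g) (h : B ⟶ C) :
    T.map₂ (σ ▷ h) ≫ (T.mapComp g h).hom = (T.mapComp f h).hom ≫ T.map₂ σ ▷ T.map h :=
  (T.isLeftKan_sq (f ≫ h)).hom_ext (by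
    simp only [whiskerLeft_comp, sq_map₂_assoc, sq_mapComp, sq_mapComp_assoc, sqComp]
    calc
      _ = 𝟙 _ ⊗≫ (σ ▷ (h ≫ T.y C) ≫ g ◁ (T.sq h).hom) ⊗≫ (T.sq g).hom ▷ T.map h ⊗≫ 𝟙 _ := by
        bicategory
      _ = 𝟙 _ ⊗≫ f ◁ (T.sq h).hom ⊗≫ (σ ▷ T.y B ≫ (T.sq g).hom) ▷ T.map h ⊗≫ 𝟙 _ := by
        rw [← whisker_exchange]
        bicategory
      _ = _ := by
        rw [← sq_map₂]
        bicategory)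

theorem map₂_associator {A B C E : K} (f : A ⟶ B) (g : B ⟶ C) (h : C ⟶ E) :
    T.map₂ (α_ f g h).hom ≫ (T.mapComp f (g ≫ h)).hom ≫ T.map f ◁ (T.mapComp g h).hom =
      (T.mapComp (f ≫ g) h).hom ≫ (T.mapComp f g).hom ▷ T.map h ≫ (α_ _ _ _).hom :=
  (T.isLeftKan_sq ((f ≫ g) ≫ h)).hom_ext (by
    simp only [whiskerLeft_comp, sq_map₂_assoc, sq_mapComp_assoc]
    calc
      _ = 𝟙 _ ⊗≫ f ◁ (T.sq (g ≫ h)).hom ⊗≫ ((T.sq f).hom ▷ T.map (g ≫ h) ≫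
            (T.y A ≫ T.map f) ◁ (T.mapComp g h).hom) ⊗≫ 𝟙 _ := by
        simp only [sqComp]
        bicategory
      _ = 𝟙 _ ⊗≫ f ◁ ((T.sq (g ≫ h)).hom ≫ T.y B ◁ (T.mapComp g h).hom) ⊗≫
            (T.sq f).hom ▷ (T.map g ≫ T.map h) ⊗≫ 𝟙 _ := by
        rw [← whisker_exchange]
        bicategory
      _ = 𝟙 _ ⊗≫ (f ≫ g) ◁ (T.sq h).hom ⊗≫ T.sqComp f g ▷ T.map h ⊗≫ 𝟙 _ := by
        rw [sq_mapComp]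
        simp only [sqComp]
        bicategory
      _ = _ := by
        rw [← sq_mapComp]
        simp only [sqComp]
        bicategory)

theorem map₂_associator' {A B C E : K} (f : A ⟶ B) (g : B ⟶ C) (h : C ⟶ E) :
    T.map₂ (α_ f g h).hom = (T.mapComp (f ≫ g) h).hom ≫ (T.mapComp f g).hom ▷ T.map h ≫
      (α_ _ _ _).hom ≫ T.map f ◁ (T.mapComp g h).inv ≫ (T.mapComp f (g ≫ h)).inv := by
  have := T.map₂_associator f g h
  rw [← cancel_mono (T.mapComp f (g ≫ h)).hom,
    ← cancel_mono (T.map f ◁ (T.mapComp g h).hom), Category.assoc, this]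
  simp

theorem map₂_leftUnitor {A B : K} (f : A ⟶ B) :
    T.map₂ (λ_ f).hom = (T.mapComp (𝟙 A) f).hom ≫ (T.mapId A).hom ▷ T.map f ≫ (λ_ _).hom :=
  (T.isLeftKan_sq (𝟙 A ≫ f)).hom_ext (by
    simp only [whiskerLeft_comp, sq_map₂, sq_mapComp_assoc]
    symm
    calc
      _ = 𝟙 _ ⊗≫ 𝟙 A ◁ (T.sq f).hom ⊗≫
            ((T.sq (𝟙 A)).hom ≫ T.y A ◁ (T.mapId A).hom) ▷ T.map f ⊗≫ 𝟙 _ := by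
        simp only [sqComp]
        bicategory
      _ = _ := by
        rw [sq_mapId]
        bicategory)

theorem map₂_rightUnitor {A B : K} (f : A ⟶ B) :
    T.map₂ (ρ_ f).hom = (T.mapComp f (𝟙 B)).hom ≫ T.map f ◁ (T.mapId B).hom ≫ (ρ_ _).hom :=
  (T.isLeftKan_sq (f ≫ 𝟙 B)).hom_ext (by
    simp only [whiskerLeft_comp, sq_map₂, sq_mapComp_assoc]
    symm
    calc
      _ = 𝟙 _ ⊗≫ f ◁ (T.sq (𝟙 B)).hom ⊗≫ ((T.sq f).hom ▷ T.map (𝟙 B) ≫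
            (T.y A ≫ T.map f) ◁ (T.mapId B).hom) ⊗≫ 𝟙 _ := by
        simp only [sqComp]
        bicategory
      _ = 𝟙 _ ⊗≫ f ◁ ((T.sq (𝟙 B)).hom ≫ T.y B ◁ (T.mapId B).hom) ⊗≫ (T.sq f).hom ▷ 𝟙 _ ⊗≫
            𝟙 _ := by
        rw [← whisker_exchange]
        bicategory
      _ = _ := by
        rw [sq_mapId]
        bicategory)

/-- The 1-cell `D f` as a morphism of free algebras. -/
def freeMap {A B : K} (f : A ⟶ B) : T.free A ⟶ T.free B where
  hom := T.map f
  preserves g := T.preserves g (f ≫ T.y B)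

/-- The pseudofunctor `J_D : K ⥤ K_D`, sending `A` to the free algebra on `A`. -/
noncomputable def J : Pseudofunctor K T.Kleisli where
  obj A := (⟨T.free A, A, rfl⟩ : T.FreeAlg)
  map f := InducedBicategory.mkHom (T.freeMap f)
  map₂ {A B f g} σ := ⟨(⟨T.map₂ σ⟩ : PsAlg.Hom₂ (T.freeMap f) (T.freeMap g))⟩
  mapId A := InducedBicategory.isoMk (PsAlg.isoMk (T.mapId A))
  mapComp f g := InducedBicategory.isoMk (PsAlg.isoMk (T.mapComp f g))
  map₂_id f := by ext; exact T.map₂_id f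
  map₂_comp σ τ := by ext; exact T.map₂_comp σ τ
  map₂_whisker_left f g h σ := by
    ext
    exact ((Iso.eq_comp_inv (T.mapComp f h)).2 (T.map₂_whiskerLeft f σ)).trans
      (Category.assoc _ _ _)
  map₂_whisker_right {_ _ _ f g} σ h := by
    ext
    exact ((Iso.eq_comp_inv (T.mapComp g h)).2 (T.map₂_whiskerRight σ h)).trans
      (Category.assoc _ _ _)
  map₂_associator f g h := by
    ext
    exact T.map₂_associator' f g h
  map₂_left_unitor f := by ext; exact T.map₂_leftUnitor f
  map₂_right_unitor f := by ext; exact T.map₂_rightUnitor f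

end LeftKanPseudomonad

/-! ## Colax adjunctions and biadjunctions -/

section Adjunction

variable {C : Type u₁} [Bicategory.{w₁, v₁} C] {E : Type u₂} [Bicategory.{w₂, v₂} E]

/-- A colax natural transformation between pseudofunctors: its 2-cells have the form
`F.map f ≫ app b ⟶ app a ≫ G.map f`. -/
abbrev ColaxTrans (F G : Pseudofunctor C E) := Oplax.OplaxTrans F.toOplax G.toOplax

namespace ColaxTrans

section Cells

variable (F : Pseudofunctor C E)

theorem map_cell_naturality {a b a' b' : C} {f g : a ⟶ b} {h k : a' ⟶ b'} {p : a ⟶ a'} {q : b ⟶ b'}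
    {n : f ≫ q ⟶ p ≫ h} {n' : g ≫ q ⟶ p ≫ k} {σ : f ⟶ g} {τ : h ⟶ k}
    (e : σ ▷ q ≫ n' = n ≫ p ◁ τ) :
    F.map₂ σ ▷ F.map q ≫ (F.mapComp g q).inv ≫ F.map₂ n' ≫ (F.mapComp p k).hom =
      ((F.mapComp f q).inv ≫ F.map₂ n ≫ (F.mapComp p h).hom) ≫ F.map p ◁ F.map₂ τ := by
  have := congrArg (fun x ↦ (F.mapComp f q).inv ≫ F.map₂ x ≫ (F.mapComp p k).hom) e
  simpa using this

theorem map₂_comp_comp {a b : C} {f g h : a ⟶ b} (σ : f ⟶ g) (τ : g ⟶ h) {k : F.obj a ⟶ F.obj b}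
    (ρ : F.map h ⟶ k) : F.map₂ σ ≫ F.map₂ τ ≫ ρ = F.map₂ (σ ≫ τ) ≫ ρ := by
  simp

theorem map₂_id_comp {a b : C} {f : a ⟶ b} {k : F.obj a ⟶ F.obj b} (ρ : F.map f ⟶ k) :
    ρ = F.map₂ (𝟙 f) ≫ ρ := by
  simp

theorem map_cell_id {a a' : C} {p : a ⟶ a'} {i : a ⟶ a} {j : a' ⟶ a'} {n : i ≫ p ⟶ p ≫ j}
    {u : i ⟶ 𝟙 a} {v : j ⟶ 𝟙 a'} {u' : F.map i ⟶ 𝟙 (F.obj a)} {v' : F.map j ⟶ 𝟙 (F.obj a')}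
    (hu : u' = F.map₂ u ≫ (F.mapId a).hom) (hv : v' = F.map₂ v ≫ (F.mapId a').hom)
    (e : n ≫ p ◁ v = u ▷ p ≫ (λ_ p).hom ≫ (ρ_ p).inv) :
    ((F.mapComp i p).inv ≫ F.map₂ n ≫ (F.mapComp p j).hom) ≫
        F.map p ◁ v' =
      u' ▷ F.map p ≫ (λ_ (F.map p)).hom ≫ (ρ_ (F.map p)).inv := by
  subst hu hv
  have := congrArg (fun x ↦ (F.mapComp i p).inv ≫ F.map₂ x ≫ (F.mapComp p (𝟙 a')).hom ≫
    F.map p ◁ (F.mapId a').hom) e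
  simp at this
  have h : F.map₂ (ρ_ p).inv ≫ (F.mapComp p (𝟙 a')).hom ≫ F.map p ◁ (F.mapId a').hom =
    (ρ_ (F.map p)).inv := by
    rw [← cancel_epi (F.map₂ (ρ_ p).hom), ← F.map₂_comp_assoc]
    simp
  rw [h] at this
  simp [this]

theorem map_cell_comp {a b c a' b' c' : C} {p : a ⟶ a'} {q : b ⟶ b'} {r : c ⟶ c'}
    {f : a ⟶ b} {g : b ⟶ c} {h : a ⟶ c} {f' : a' ⟶ b'} {g' : b' ⟶ c'} {h' : a' ⟶ c'}
    {nf : f ≫ q ⟶ p ≫ f'} {ng : g ≫ r ⟶ q ≫ g'} {nh : h ≫ r ⟶ p ≫ h'}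
    {u : h ⟶ f ≫ g} {v : h' ⟶ f' ≫ g'} {u' : F.map h ⟶ F.map f ≫ F.map g}
    {v' : F.map h' ⟶ F.map f' ≫ F.map g'}
    (hu : u' = F.map₂ u ≫ (F.mapComp f g).hom) (hv : v' = F.map₂ v ≫ (F.mapComp f' g').hom)
    (e : nh ≫ p ◁ v = u ▷ r ≫ (α_ _ _ _).hom ≫ f ◁ ng ≫ (α_ _ _ _).inv ≫ nf ▷ g' ≫ (α_ _ _ _).hom) :
    ((F.mapComp h r).inv ≫ F.map₂ nh ≫ (F.mapComp p h').hom) ≫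
        F.map p ◁ v' =
      u' ▷ F.map r ≫ (α_ _ _ _).hom ≫
        F.map f ◁ ((F.mapComp g r).inv ≫ F.map₂ ng ≫ (F.mapComp q g').hom) ≫ (α_ _ _ _).inv ≫
          ((F.mapComp f q).inv ≫ F.map₂ nf ≫ (F.mapComp p f').hom) ▷ F.map g' ≫
            (α_ _ _ _).hom := by
  subst hu hv
  have := congrArg (fun x ↦ (F.mapComp h r).inv ≫ F.map₂ x ≫ (F.mapComp p _).hom ≫
    F.map p ◁ (F.mapComp f' g').hom) e
  have h : (F.mapComp f (q ≫ g')).inv ≫ F.map₂ (α_ f q g').inv ≫ (F.mapComp (f ≫ q) g').hom =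
      F.map f ◁ (F.mapComp q g').hom ≫ (α_ (F.map f) (F.map q) (F.map g')).inv ≫
        (F.mapComp f q).inv ▷ F.map g' := by
    rw [Iso.inv_comp_eq, ← cancel_epi (F.map₂ (α_ f q g').hom), ← F.map₂_comp_assoc]
    simp
  simp [reassoc_of% h] at this
  simp [this]

variable (P : Pseudofunctor C C)

theorem counit_cell_id {x : C} {i : x ⟶ x} {p : P.obj x ⟶ x} {n : P.map i ≫ p ⟶ p ≫ i}
    {m : P.map (𝟙 x) ≫ p ⟶ p ≫ 𝟙 x} {u : i ⟶ 𝟙 x} (e₁ : P.map₂ u ▷ p ≫ m = n ≫ p ◁ u)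
    (e₂ : m ≫ p ◁ 𝟙 (𝟙 x) = (P.mapId x).hom ▷ p ≫ (λ_ p).hom ≫ (ρ_ p).inv) :
    n ≫ p ◁ u = (P.map₂ u ≫ (P.mapId x).hom) ▷ p ≫ (λ_ p).hom ≫ (ρ_ p).inv := by
  simp only [whiskerLeft_id, Category.comp_id] at e₂
  rw [← e₁, e₂, comp_whiskerRight, Category.assoc]

theorem counit_cell_comp {x y z : C} {p : P.obj x ⟶ x} {q : P.obj y ⟶ y} {r : P.obj z ⟶ z}
    {f : x ⟶ y} {g : y ⟶ z} {h : x ⟶ z} {n : P.map h ≫ r ⟶ p ≫ h}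
    {m : P.map (f ≫ g) ≫ r ⟶ p ≫ f ≫ g} {u : h ⟶ f ≫ g}
    {nf : P.map f ≫ q ⟶ p ≫ f} {ng : P.map g ≫ r ⟶ q ≫ g}
    (e₁ : P.map₂ u ▷ r ≫ m = n ≫ p ◁ u)
    (e₂ : m ≫ p ◁ 𝟙 (f ≫ g) = (P.mapComp f g).hom ▷ r ≫ (α_ _ _ _).hom ≫ P.map f ◁ ng ≫
      (α_ _ _ _).inv ≫ nf ▷ g ≫ (α_ _ _ _).hom) :
    n ≫ p ◁ u = (P.map₂ u ≫ (P.mapComp f g).hom) ▷ r ≫ (α_ _ _ _).hom ≫ P.map f ◁ ng ≫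
      (α_ _ _ _).inv ≫ nf ▷ g ≫ (α_ _ _ _).hom := by
  simp only [whiskerLeft_id, Category.comp_id] at e₂
  rw [← e₁, e₂, comp_whiskerRight, Category.assoc]

theorem unit_cell_id {x : C} {i : x ⟶ x} {p : x ⟶ P.obj x} {n : i ≫ p ⟶ p ≫ P.map i}
    {m : 𝟙 x ≫ p ⟶ p ≫ P.map (𝟙 x)} {u : i ⟶ 𝟙 x} (e₁ : u ▷ p ≫ m = n ≫ p ◁ P.map₂ u)
    (e₂ : m ≫ p ◁ (P.mapId x).hom = 𝟙 (𝟙 x) ▷ p ≫ (λ_ p).hom ≫ (ρ_ p).inv) :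
    n ≫ p ◁ (P.map₂ u ≫ (P.mapId x).hom) = u ▷ p ≫ (λ_ p).hom ≫ (ρ_ p).inv := by
  simp only [id_whiskerRight, Category.id_comp] at e₂
  rw [← e₂, reassoc_of% e₁, whiskerLeft_comp]

theorem unit_cell_comp {x y z : C} {p : x ⟶ P.obj x} {q : y ⟶ P.obj y} {r : z ⟶ P.obj z}
    {f : x ⟶ y} {g : y ⟶ z} {h : x ⟶ z} {n : h ≫ r ⟶ p ≫ P.map h}
    {m : (f ≫ g) ≫ r ⟶ p ≫ P.map (f ≫ g)} {u : h ⟶ f ≫ g}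
    {nf : f ≫ q ⟶ p ≫ P.map f} {ng : g ≫ r ⟶ q ≫ P.map g}
    (e₁ : u ▷ r ≫ m = n ≫ p ◁ P.map₂ u)
    (e₂ : m ≫ p ◁ (P.mapComp f g).hom = 𝟙 (f ≫ g) ▷ r ≫ (α_ _ _ _).hom ≫ f ◁ ng ≫
      (α_ _ _ _).inv ≫ nf ▷ P.map g ≫ (α_ _ _ _).hom) :
    n ≫ p ◁ (P.map₂ u ≫ (P.mapComp f g).hom) = u ▷ r ≫ (α_ _ _ _).hom ≫ f ◁ ng ≫
      (α_ _ _ _).inv ≫ nf ▷ P.map g ≫ (α_ _ _ _).hom := by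
  simp only [id_whiskerRight, Category.id_comp] at e₂
  rw [← e₂, reassoc_of% e₁, whiskerLeft_comp]

end Cells

/-- A colax natural transformation is pseudonatural if its 2-cells are invertible. -/
def IsPseudo {F G : Pseudofunctor C E} (α : ColaxTrans F G) : Prop :=
  ∀ {a b : C} (f : a ⟶ b), IsIso (α.naturality f)

variable {F : Pseudofunctor C E} {U : Pseudofunctor E C}

/-- The colax natural transformation `Fη : F ⟶ FUF`. -/
@[simps]
def mapUnit (F : Pseudofunctor C E) {U : Pseudofunctor E C}
    (η : ColaxTrans (Pseudofunctor.id C) (F.comp U)) : ColaxTrans F (F.comp (U.comp F)) where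
  app A := F.map (η.app A)
  naturality {A B} f := (F.mapComp f (η.app B)).inv ≫ F.map₂ (η.naturality f) ≫
    (F.mapComp (η.app A) (U.map (F.map f))).hom
  naturality_naturality σ := map_cell_naturality F (η.naturality_naturality σ)
  naturality_id A := map_cell_id F (map₂_id_comp F _) (map₂_comp_comp F _ _ _)
    (η.naturality_id A)
  naturality_comp f g := map_cell_comp F (map₂_id_comp F _) (map₂_comp_comp F _ _ _)
    (η.naturality_comp f g)

/-- The colax natural transformation `ϵF : FUF ⟶ F`. -/
@[simps]
def counitAt (F : Pseudofunctor C E) {U : Pseudofunctor E C}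
    (ϵ : ColaxTrans (U.comp F) (Pseudofunctor.id E)) : ColaxTrans (F.comp (U.comp F)) F where
  app A := ϵ.app (F.obj A)
  naturality f := ϵ.naturality (F.map f)
  naturality_naturality σ := ϵ.naturality_naturality (F.map₂ σ)
  naturality_id A := counit_cell_id (U.comp F)
    (ϵ.naturality_naturality (F.mapId A).hom) (ϵ.naturality_id (F.obj A))
  naturality_comp f g := counit_cell_comp (U.comp F)
    (ϵ.naturality_naturality (F.mapComp f g).hom) (ϵ.naturality_comp (F.map f) (F.map g))

/-- The colax natural transformation `ηU : U ⟶ UFU`. -/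
@[simps]
def unitAt (U : Pseudofunctor E C) {F : Pseudofunctor C E}
    (η : ColaxTrans (Pseudofunctor.id C) (F.comp U)) : ColaxTrans U (U.comp (F.comp U)) where
  app X := η.app (U.obj X)
  naturality f := η.naturality (U.map f)
  naturality_naturality σ := η.naturality_naturality (U.map₂ σ)
  naturality_id X := unit_cell_id (F.comp U)
    (η.naturality_naturality (U.mapId X).hom) (η.naturality_id (U.obj X))
  naturality_comp f g := unit_cell_comp (F.comp U)
    (η.naturality_naturality (U.mapComp f g).hom) (η.naturality_comp (U.map f) (U.map g))

/-- The colax natural transformation `Uϵ : UFU ⟶ U`. -/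
@[simps]
def mapCounit (U : Pseudofunctor E C) {F : Pseudofunctor C E}
    (ϵ : ColaxTrans (U.comp F) (Pseudofunctor.id E)) : ColaxTrans (U.comp (F.comp U)) U where
  app X := U.map (ϵ.app X)
  naturality {X Y} f := (U.mapComp (F.map (U.map f)) (ϵ.app Y)).inv ≫ U.map₂ (ϵ.naturality f) ≫
    (U.mapComp (ϵ.app X) f).hom
  naturality_naturality σ := map_cell_naturality U (ϵ.naturality_naturality σ)
  naturality_id X := map_cell_id U (map₂_comp_comp U _ _ _) (map₂_id_comp U _)
    (ϵ.naturality_id X)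
  naturality_comp f g := map_cell_comp U (map₂_comp_comp U _ _ _) (map₂_id_comp U _)
    (ϵ.naturality_comp f g)

end ColaxTrans

/-- A modification between colax natural transformations. -/
abbrev ColaxTrans.Modification {F G : Pseudofunctor C E} (α β : ColaxTrans F G) :=
  Oplax.OplaxTrans.Modification (F := F.toOplax) (G := G.toOplax) α β

/-- A colax adjunction with left colax adjoint `F` and right colax adjoint `U`. -/
structure ColaxAdjunction (F : Pseudofunctor C E) (U : Pseudofunctor E C) where
  /-- the unit `η : 1 ⟶ UF` -/
  unit : ColaxTrans (Pseudofunctor.id C) (F.comp U)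
  /-- the counit `ϵ : FU ⟶ 1` -/
  counit : ColaxTrans (U.comp F) (Pseudofunctor.id E)
  /-- the modification `Ψ : ϵF ∘ Fη ⟶ 1` -/
  Ψ : ColaxTrans.Modification
    (Oplax.OplaxTrans.vcomp (ColaxTrans.mapUnit F unit) (ColaxTrans.counitAt F counit))
    (Oplax.OplaxTrans.id F.toOplax)
  /-- the modification `Φ : 1 ⟶ Uϵ ∘ ηU` -/
  Φ : ColaxTrans.Modification (Oplax.OplaxTrans.id U.toOplax)
    (Oplax.OplaxTrans.vcomp (ColaxTrans.unitAt U unit) (ColaxTrans.mapCounit U counit))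
  /-- the swallowtail identity on the unit: the pasting
  `η ⟶ Uϵ_F ∘ η_UF ∘ η ⟶ Uϵ_F ∘ UFη ∘ η ⟶ η` is the identity -/
  swallowtail_unit (A : C) :
    (ρ_ (unit.app A)).inv ≫ unit.app A ◁ Φ.app (F.obj A) ≫
      (α_ (unit.app A) (unit.app (U.obj (F.obj A))) (U.map (counit.app (F.obj A)))).inv ≫
      unit.naturality (unit.app A) ▷ U.map (counit.app (F.obj A)) ≫
      (α_ (unit.app A) (U.map (F.map (unit.app A))) (U.map (counit.app (F.obj A)))).hom ≫
      unit.app A ◁ ((U.mapComp (F.map (unit.app A)) (counit.app (F.obj A))).inv ≫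
        U.map₂ (Ψ.app A) ≫ (U.mapId (F.obj A)).hom) ≫
      (ρ_ (unit.app A)).hom = 𝟙 (unit.app A)
  /-- the swallowtail identity on the counit: the pasting
  `ϵ ⟶ ϵ ∘ FUϵ ∘ Fη_U ⟶ ϵ ∘ ϵ_FU ∘ Fη_U ⟶ ϵ` is the identity -/
  swallowtail_counit (X : E) :
    (λ_ (counit.app X)).inv ≫
      ((F.mapId (U.obj X)).inv ≫ F.map₂ (Φ.app X) ≫
        (F.mapComp (unit.app (U.obj X)) (U.map (counit.app X))).hom) ▷ counit.app X ≫
      (α_ (F.map (unit.app (U.obj X))) (F.map (U.map (counit.app X))) (counit.app X)).hom ≫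
      F.map (unit.app (U.obj X)) ◁ counit.naturality (counit.app X) ≫
      (α_ (F.map (unit.app (U.obj X))) (counit.app (F.obj (U.obj X))) (counit.app X)).inv ≫
      Ψ.app (U.obj X) ▷ counit.app X ≫ (λ_ (counit.app X)).hom = 𝟙 (counit.app X)

/-- A colax adjunction is a biadjunction if its unit and counit are pseudonatural and its two
modifications are invertible. -/
structure ColaxAdjunction.IsBiadjunction {F : Pseudofunctor C E} {U : Pseudofunctor E C}
    (adj : ColaxAdjunction F U) : Prop where
  unit_isPseudo : adj.unit.IsPseudo
  counit_isPseudo : adj.counit.IsPseudo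
  isIso_Ψ (A : C) : IsIso (adj.Ψ.app A)
  isIso_Φ (X : E) : IsIso (adj.Φ.app X)

/-- A colax natural transformation `G ∘ (J ∘ H) ⟶ 1`, viewed with source `(G ∘ J) ∘ H`; its 1-cell
and 2-cell components are unchanged. -/
@[simps]
def ColaxTrans.reassociate {B : Type u} [Bicategory.{w, v} B] {H : Pseudofunctor E B}
    {J : Pseudofunctor B C} {G : Pseudofunctor C E}
    (α : ColaxTrans (H.comp (J.comp G)) (Pseudofunctor.id E)) :
    ColaxTrans ((H.comp J).comp G) (Pseudofunctor.id E) where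
  app := α.app
  naturality := α.naturality
  naturality_naturality := α.naturality_naturality
  naturality_id X := (α.naturality_id X).trans (congrArg (fun x ↦ x ▷ α.app X ≫ _)
    (map₂_comp_comp G _ _ _))
  naturality_comp {_ _ c} f g := (α.naturality_comp f g).trans
    (congrArg (fun x ↦ x ▷ α.app c ≫ _) (map₂_comp_comp G _ _ _))

end Adjunction

end CategoryTheory

/-! A colax adjunction amounts to hom-wise adjunctions. Fix `G`, `R` and a colax counit `e`, and for
each `X` choose a 1-cell `u X : X ⟶ R (G X)` and a 2-cell `ψ X : G (u X) ≫ e ⟶ 1`. If, for all `X`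
and `Y`, pasting with these cells makes `k ↦ G k ≫ e` left adjoint to `f ↦ u X ≫ R f`, that is, if
`(k ⟶ u X ≫ R f) → (G k ≫ e ⟶ f)` is bijective, then the unit 2-cells and the modification `Φ` are
defined by their transposes. Every axiom is checked by transposing both sides
(`CounitLifting.colaxAdjunction`). The hom-functors are only adjoint, not inverse to each other, so
the unit comes out colax.

For the theorem take `u = J η` and `ψ = Ψ`. Since `Ψ` and the counit cells are invertible, it
suffices that `σ ↦ G σ ▷ s` is a bijection from 2-cells `k ⟶ J v` to 2-cells `G k ≫ s ⟶ G (J v) ≫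
s`. Two fully faithful functors move this question into `K`. Restriction along `y` embeds morphisms
of free algebras `DA ⟶ DB` into 1-cells `A ⟶ DB` and sends `J v` to `v ≫ y`. Transposition along the
biadjunction sends `G k ≫ s` to `res k ≫ z`, where `z : D (H Y) ⟶ H Y` is the transpose of `G m ≫ s`
and `m` is the multiplication. What remains is that whiskering by `z` is bijective on 2-cells `g ⟶ v
≫ y`, which holds because `z` is left adjoint to `y` with invertible counit
(`whiskerRight_bijective`).

The unit of this adjunction, and one triangle identity, come from the fact that `1` is the left Kan
extension of `y` along `y`. The other triangle identity requires that an endomorphism of `z`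
restricting to the identity along `y` is the identity (`action_hom_ext`). This follows from the
2-cell `κ : m ≫ D y ⟶ 1`, for which `κ ▷ m` is invertible (`exists_mul_counit`). -/

namespace CategoryTheory

/-! ### Coherence laws of a pseudofunctor, with the comparison cells moved to one side -/

namespace Pseudofunctor

variable {C : Type u₁} [Bicategory.{w₁, v₁} C] {E : Type u₂} [Bicategory.{w₂, v₂} E]
  (F : Pseudofunctor C E)

theorem map₂_whiskerLeft_mapComp {a b c : C} (f : a ⟶ b) {g h : b ⟶ c} (η : g ⟶ h) :
    F.map₂ (f ◁ η) ≫ (F.mapComp f h).hom = (F.mapComp f g).hom ≫ F.map f ◁ F.map₂ η := by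
  simp

theorem map₂_whiskerRight_mapComp {a b c : C} {f g : a ⟶ b} (η : f ⟶ g) (h : b ⟶ c) :
    F.map₂ (η ▷ h) ≫ (F.mapComp g h).hom = (F.mapComp f h).hom ≫ F.map₂ η ▷ F.map h := by
  simp

theorem map₂_rightUnitor_inv_mapComp {a b : C} (f : a ⟶ b) :
    F.map₂ (ρ_ f).inv ≫ (F.mapComp f (𝟙 b)).hom ≫ F.map f ◁ (F.mapId b).hom =
      (ρ_ (F.map f)).inv := by
  rw [← cancel_epi (F.map₂ (ρ_ f).hom), ← F.map₂_comp_assoc]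
  simp

theorem map₂_leftUnitor_inv_mapComp {a b : C} (f : a ⟶ b) :
    F.map₂ (λ_ f).inv ≫ (F.mapComp (𝟙 a) f).hom ≫ (F.mapId a).hom ▷ F.map f =
      (λ_ (F.map f)).inv := by
  rw [← cancel_epi (F.map₂ (λ_ f).hom), ← F.map₂_comp_assoc]
  simp

theorem map₂_associator_mapComp {a b c d : C} (f : a ⟶ b) (g : b ⟶ c) (h : c ⟶ d) :
    F.map₂ (α_ f g h).hom ≫ (F.mapComp f (g ≫ h)).hom ≫ F.map f ◁ (F.mapComp g h).hom =
      (F.mapComp (f ≫ g) h).hom ≫ (F.mapComp f g).hom ▷ F.map h ≫ (α_ _ _ _).hom := by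
  simp

theorem map₂_associator_inv_mapComp {a b c d : C} (f : a ⟶ b) (g : b ⟶ c) (h : c ⟶ d) :
    F.map₂ (α_ f g h).inv ≫ (F.mapComp (f ≫ g) h).hom ≫ (F.mapComp f g).hom ▷ F.map h =
      (F.mapComp f (g ≫ h)).hom ≫ F.map f ◁ (F.mapComp g h).hom ≫ (α_ _ _ _).inv := by
  rw [← cancel_epi (F.map₂ (α_ f g h).hom), ← F.map₂_comp_assoc]
  simp

end Pseudofunctor

/-! ### Colax adjunctions from a counit with a universal property -/

section Lifting

variable {C : Type u₁} [Bicategory.{w₁, v₁} C] {E : Type u₂} [Bicategory.{w₂, v₂} E]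

/-- Objectwise data for a colax adjunction with left colax adjoint `G`, right colax adjoint `R` and
counit `ε`: 1-cells `u X : X ⟶ RGX` with 2-cells `G (u X) ≫ ε ⟶ 1`. -/
structure CounitLifting (G : Pseudofunctor C E) (R : Pseudofunctor E C) where
  /-- the 1-cells of the counit -/
  e (Y : E) : G.obj (R.obj Y) ⟶ Y
  /-- the 2-cells of the counit -/
  en {Y Z : E} (f : Y ⟶ Z) : G.map (R.map f) ≫ e Z ⟶ e Y ≫ f
  en_naturality {Y Z : E} {f g : Y ⟶ Z} (τ : f ⟶ g) :
    G.map₂ (R.map₂ τ) ▷ e Z ≫ en g = en f ≫ e Y ◁ τ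
  en_id (Y : E) : en (𝟙 Y) =
    (G.map₂ (R.mapId Y).hom ≫ (G.mapId (R.obj Y)).hom) ▷ e Y ≫ (λ_ (e Y)).hom ≫ (ρ_ (e Y)).inv
  en_comp {X Y Z : E} (f : X ⟶ Y) (g : Y ⟶ Z) : en (f ≫ g) =
    (G.map₂ (R.mapComp f g).hom ≫ (G.mapComp (R.map f) (R.map g)).hom) ▷ e Z ≫
      (α_ _ _ _).hom ≫ G.map (R.map f) ◁ en g ≫ (α_ _ _ _).inv ≫ en f ▷ g ≫ (α_ _ _ _).hom
  /-- the 1-cells of the unit -/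
  u (X : C) : X ⟶ R.obj (G.obj X)
  /-- the 2-cells of the first triangle -/
  ψ (X : C) : G.map (u X) ≫ e (G.obj X) ⟶ 𝟙 (G.obj X)

namespace CounitLifting

variable {G : Pseudofunctor C E} {R : Pseudofunctor E C} (S : CounitLifting G R)

/-- The 2-cell `G (u ≫ R f) ≫ ε ⟶ f`. -/
def cell {X : C} {Y : E} (f : G.obj X ⟶ Y) : G.map (S.u X ≫ R.map f) ≫ S.e Y ⟶ f :=
  (G.mapComp (S.u X) (R.map f)).hom ▷ S.e Y ≫ (α_ _ _ _).hom ≫ G.map (S.u X) ◁ S.en f ≫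
    (α_ _ _ _).inv ≫ S.ψ X ▷ f ≫ (λ_ f).hom

/-- The transpose of a 2-cell `k ⟶ u ≫ R f`. -/
def tr {X : C} {Y : E} {k : X ⟶ R.obj Y} (f : G.obj X ⟶ Y) (σ : k ⟶ S.u X ≫ R.map f) :
    G.map k ≫ S.e Y ⟶ f :=
  G.map₂ σ ▷ S.e Y ≫ S.cell f

theorem tr_comp_left {X : C} {Y : E} {k l : X ⟶ R.obj Y} {f : G.obj X ⟶ Y} (ρ : k ⟶ l)
    (σ : l ⟶ S.u X ≫ R.map f) : S.tr f (ρ ≫ σ) = G.map₂ ρ ▷ S.e Y ≫ S.tr f σ := by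
  simp [tr]

theorem cell_naturality {X : C} {Y : E} {f g : G.obj X ⟶ Y} (τ : f ⟶ g) :
    G.map₂ (S.u X ◁ R.map₂ τ) ▷ S.e Y ≫ S.cell g = S.cell f ≫ τ := by
  unfold cell
  calc
    _ = (G.mapComp (S.u X) (R.map f)).hom ▷ S.e Y ⊗≫
        G.map (S.u X) ◁ (G.map₂ (R.map₂ τ) ▷ S.e Y ≫ S.en g) ⊗≫ S.ψ X ▷ g ⊗≫ 𝟙 _ := by
      rw [G.map₂_whisker_left]
      simp [bicategoricalComp]
    _ = (G.mapComp (S.u X) (R.map f)).hom ▷ S.e Y ⊗≫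
        G.map (S.u X) ◁ S.en f ⊗≫ ((G.map (S.u X) ≫ S.e _) ◁ τ ≫ S.ψ X ▷ g) ⊗≫ 𝟙 _ := by
      rw [en_naturality]
      bicategory
    _ = _ := by
      rw [whisker_exchange]
      bicategory

theorem tr_map₂ {X : C} {Y : E} {k : X ⟶ R.obj Y} {f g : G.obj X ⟶ Y}
    (σ : k ⟶ S.u X ≫ R.map f) (τ : f ⟶ g) :
    S.tr g (σ ≫ S.u X ◁ R.map₂ τ) = S.tr f σ ≫ τ := by
  rw [tr, tr, G.map₂_comp, comp_whiskerRight, Category.assoc, cell_naturality, Category.assoc]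

/-- By `en_id` the counit cell at an identity consists of comparison cells only. They cancel against
the inverse comparison in the argument of `tr`, so that `ψ` alone is left. -/
theorem tr_id (X : C) : S.tr (𝟙 (G.obj X)) ((ρ_ (S.u X)).inv ≫ S.u X ◁ (R.mapId _).inv) =
    S.ψ X := by
  have h : G.map₂ ((ρ_ (S.u X)).inv ≫ S.u X ◁ (R.mapId _).inv) ≫ (G.mapComp _ _).hom ≫
      G.map (S.u X) ◁ (G.map₂ (R.mapId (G.obj X)).hom ≫ (G.mapId (R.obj (G.obj X))).hom) =
      (ρ_ (G.map (S.u X))).inv := by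
    rw [whiskerLeft_comp, ← reassoc_of% G.map₂_whiskerLeft_mapComp, ← G.map₂_comp_assoc,
      ← G.map₂_rightUnitor_inv_mapComp]
    simp
  unfold tr cell
  rw [en_id]
  calc
    _ = (G.map₂ ((ρ_ (S.u X)).inv ≫ S.u X ◁ (R.mapId _).inv) ≫ (G.mapComp _ _).hom ≫
      G.map (S.u X) ◁ (G.map₂ (R.mapId (G.obj X)).hom ≫ (G.mapId (R.obj (G.obj X))).hom)) ▷
        S.e (G.obj X) ⊗≫ S.ψ X ▷ 𝟙 _ ⊗≫ 𝟙 _ := by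
      bicategory
    _ = _ := by
      rw [h]
      bicategory

theorem cell_comp {X : C} {Y Z : E} (f : G.obj X ⟶ Y) (g : Y ⟶ Z) :
    G.map₂ ((α_ _ _ _).hom ≫ S.u X ◁ (R.mapComp f g).inv) ▷ S.e Z ≫ S.cell (f ≫ g) =
      (G.mapComp _ (R.map g)).hom ▷ S.e Z ≫ (α_ _ _ _).hom ≫ G.map _ ◁ S.en g ≫
        (α_ _ _ _).inv ≫ S.cell f ▷ g := by
  have h : G.map₂ ((α_ _ _ _).hom ≫ S.u X ◁ (R.mapComp f g).inv) ≫
      (G.mapComp (S.u X) (R.map (f ≫ g))).hom ≫ G.map (S.u X) ◁ (G.map₂ (R.mapComp f g).hom ≫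
        (G.mapComp (R.map f) (R.map g)).hom) = (G.mapComp _ (R.map g)).hom ≫
      (G.mapComp (S.u X) (R.map f)).hom ▷ _ ≫ (α_ _ _ _).hom := by
    rw [whiskerLeft_comp, ← reassoc_of% G.map₂_whiskerLeft_mapComp, ← G.map₂_comp_assoc,
      ← G.map₂_associator_mapComp]
    simp
  unfold cell
  rw [en_comp]
  calc
    _ = (G.map₂ ((α_ _ _ _).hom ≫ S.u X ◁ (R.mapComp f g).inv) ≫
      (G.mapComp (S.u X) (R.map (f ≫ g))).hom ≫ G.map (S.u X) ◁ (G.map₂ (R.mapComp f g).hom ≫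
        (G.mapComp (R.map f) (R.map g)).hom)) ▷ S.e Z ⊗≫ G.map (S.u X) ◁ (G.map (R.map f) ◁ S.en g
        ⊗≫ S.en f ▷ g) ⊗≫ S.ψ X ▷ (f ≫ g) ⊗≫ 𝟙 _ := by
      bicategory
    _ = (G.mapComp _ (R.map g)).hom ▷ S.e Z ⊗≫
      ((G.mapComp (S.u X) (R.map f)).hom ▷ _ ≫ _ ◁ S.en g) ⊗≫
         G.map (S.u X) ◁ S.en f ▷ g ⊗≫ S.ψ X ▷ (f ≫ g) ⊗≫ 𝟙 _ := by
      rw [h]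
      bicategory
    _ = _ := by
      rw [← whisker_exchange]
      bicategory

/-- Naturality of transposition in `Y`: whiskering by `R g` on one side becomes pasting with the
counit cell at `g` on the other. -/
theorem tr_comp {X : C} {Y Z : E} {k : X ⟶ R.obj Y} {f : G.obj X ⟶ Y} (g : Y ⟶ Z)
    (σ : k ⟶ S.u X ≫ R.map f) :
    S.tr (f ≫ g) (σ ▷ R.map g ≫ (α_ _ _ _).hom ≫ S.u X ◁ (R.mapComp f g).inv) =
      (G.mapComp k (R.map g)).hom ▷ S.e Z ≫ (α_ _ _ _).hom ≫ G.map k ◁ S.en g ≫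
        (α_ _ _ _).inv ≫ S.tr f σ ▷ g := by
  rw [tr, G.map₂_comp, comp_whiskerRight, Category.assoc, cell_comp, G.map₂_whisker_right, tr]
  calc
    _ = (G.mapComp k (R.map g)).hom ▷ S.e Z ⊗≫ (G.map₂ σ ▷ _ ≫ _ ◁ S.en g) ⊗≫
        S.cell f ▷ g := by
      simp [bicategoricalComp]
    _ = _ := by
      rw [← whisker_exchange]
      bicategory

/-- The lifting is universal if transposition is bijective. -/
def IsUniversal : Prop :=
  ∀ ⦃X : C⦄ ⦃Y : E⦄ (k : X ⟶ R.obj Y) (f : G.obj X ⟶ Y),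
    Function.Bijective (S.tr f : (k ⟶ S.u X ≫ R.map f) → (G.map k ≫ S.e Y ⟶ f))

variable {S} (hS : S.IsUniversal)

namespace IsUniversal

/-- The 2-cell `k ⟶ u ≫ R f` with a given transpose. -/
noncomputable def lift {X : C} {Y : E} {k : X ⟶ R.obj Y} {f : G.obj X ⟶ Y}
    (τ : G.map k ≫ S.e Y ⟶ f) : k ⟶ S.u X ≫ R.map f :=
  ((hS k f).2 τ).choose

@[simp]
theorem tr_lift {X : C} {Y : E} {k : X ⟶ R.obj Y} {f : G.obj X ⟶ Y}
    (τ : G.map k ≫ S.e Y ⟶ f) : S.tr f (hS.lift τ) = τ :=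
  ((hS k f).2 τ).choose_spec

include hS in
theorem hom_ext {X : C} {Y : E} {k : X ⟶ R.obj Y} {f : G.obj X ⟶ Y}
    {σ σ' : k ⟶ S.u X ≫ R.map f} (h : S.tr f σ = S.tr f σ') : σ = σ' :=
  (hS k f).1 h

/-- The 2-cells of the unit. -/
noncomputable def un {X X' : C} (h : X ⟶ X') : h ≫ S.u X' ⟶ S.u X ≫ R.map (G.map h) :=
  hS.lift ((G.mapComp h (S.u X')).hom ▷ S.e _ ≫ (α_ _ _ _).hom ≫ G.map h ◁ S.ψ X' ≫ (ρ_ _).hom)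

theorem tr_un {X X' : C} (h : X ⟶ X') : S.tr (G.map h) (hS.un h) =
    (G.mapComp h (S.u X')).hom ▷ S.e _ ≫ (α_ _ _ _).hom ≫ G.map h ◁ S.ψ X' ≫ (ρ_ _).hom :=
  hS.tr_lift _

/-- Naturality of transposition in `X`: pasting with the unit cell at `h` becomes whiskering by `G
h`. The composition law of the unit, the modification law for `φ` and the unit swallowtail all
reduce to this rule. -/
theorem tr_un_comp {X X' : C} {Y : E} (h : X ⟶ X') {k : X' ⟶ R.obj Y} {f : G.obj X' ⟶ Y}
    (σ : k ⟶ S.u X' ≫ R.map f) :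
    S.tr (G.map h ≫ f) (h ◁ σ ≫ (α_ _ _ _).inv ≫ hS.un h ▷ R.map f ≫ (α_ _ _ _).hom ≫
      S.u X ◁ (R.mapComp (G.map h) f).inv) =
    (G.mapComp h k).hom ▷ S.e Y ≫ (α_ _ _ _).hom ≫ G.map h ◁ S.tr f σ := by
  rw [tr_comp_left, tr_comp_left, tr_comp, tr_un]
  calc
    _ = G.map₂ (h ◁ σ) ▷ S.e Y ⊗≫ G.map₂ (α_ h (S.u X') (R.map f)).inv ▷ S.e Y ⊗≫
        (G.mapComp (h ≫ S.u X') (R.map f)).hom ▷ S.e Y ⊗≫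
        (G.map (h ≫ S.u X') ◁ S.en f ≫ (G.mapComp h (S.u X')).hom ▷ _) ⊗≫
        G.map h ◁ S.ψ X' ▷ f ⊗≫ 𝟙 _ := by
      bicategory
    _ = G.map₂ (h ◁ σ) ▷ S.e Y ⊗≫ (G.map₂ (α_ h (S.u X') (R.map f)).inv ≫
        (G.mapComp (h ≫ S.u X') (R.map f)).hom ≫ (G.mapComp h (S.u X')).hom ▷ _) ▷ S.e Y ⊗≫
        G.map h ◁ G.map (S.u X') ◁ S.en f ⊗≫ G.map h ◁ S.ψ X' ▷ f ⊗≫ 𝟙 _ := by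
      rw [whisker_exchange]
      bicategory
    _ = (G.map₂ (h ◁ σ) ≫ (G.mapComp h _).hom) ▷ S.e Y ⊗≫ G.map h ◁ S.cell f := by
      rw [G.map₂_associator_inv_mapComp, cell]
      bicategory
    _ = _ := by
      rw [G.map₂_whiskerLeft_mapComp, tr]
      bicategory

theorem un_naturality {X X' : C} {g h : X ⟶ X'} (σ : g ⟶ h) :
    σ ▷ S.u X' ≫ hS.un h = hS.un g ≫ S.u X ◁ R.map₂ (G.map₂ σ) := by
  refine hS.hom_ext ?_
  rw [tr_comp_left, tr_map₂, tr_un, tr_un]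
  calc
    _ = (G.map₂ (σ ▷ S.u X') ≫ (G.mapComp h (S.u X')).hom) ▷ S.e _ ⊗≫
        G.map h ◁ S.ψ X' ⊗≫ 𝟙 _ := by
      bicategory
    _ = (G.mapComp g (S.u X')).hom ▷ S.e _ ⊗≫
        (G.map₂ σ ▷ _ ≫ G.map h ◁ S.ψ X') ⊗≫ 𝟙 _ := by
      rw [G.map₂_whiskerRight_mapComp]
      bicategory
    _ = _ := by
      rw [← whisker_exchange]
      bicategory

theorem un_id (X : C) : hS.un (𝟙 X) ≫ S.u X ◁ (R.map₂ (G.mapId X).hom ≫ (R.mapId _).hom) =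
    (λ_ (S.u X)).hom ≫ (ρ_ (S.u X)).inv := by
  -- Composing with the inverse comparison gives the target the form `u ≫ R f`, the only one to
  -- which `hom_ext` applies.
  rw [whiskerLeft_comp, ← Category.assoc, ← cancel_mono (S.u X ◁ (R.mapId _).inv)]
  refine hS.hom_ext ?_
  simp only [Category.assoc, ← whiskerLeft_comp, Iso.hom_inv_id, Category.comp_id]
  rw [tr_map₂, tr_comp_left, tr_id, tr_un, ← cancel_epi (G.map₂ (λ_ (S.u X)).inv ▷ S.e _)]
  calc
    _ = (G.map₂ (λ_ (S.u X)).inv ≫ (G.mapComp (𝟙 X) (S.u X)).hom) ▷ S.e _ ⊗≫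
        (G.map (𝟙 X) ◁ S.ψ X ≫ (G.mapId X).hom ▷ _) ⊗≫ 𝟙 _ := by
      bicategory
    _ = (G.map₂ (λ_ (S.u X)).inv ≫ (G.mapComp (𝟙 X) (S.u X)).hom ≫
        (G.mapId X).hom ▷ _) ▷ S.e _ ⊗≫ S.ψ X ⊗≫ 𝟙 _ := by
      rw [whisker_exchange]
      bicategory
    _ = S.ψ X := by
      rw [G.map₂_leftUnitor_inv_mapComp]
      bicategory
    _ = _ := by
      rw [← comp_whiskerRight_assoc, ← G.map₂_comp]
      simp

theorem un_comp {X Y Z : C} (f : X ⟶ Y) (g : Y ⟶ Z) :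
    hS.un (f ≫ g) ≫ S.u X ◁ (R.map₂ (G.mapComp f g).hom ≫ (R.mapComp _ _).hom) =
      (α_ _ _ _).hom ≫ f ◁ hS.un g ≫ (α_ _ _ _).inv ≫ hS.un f ▷ R.map (G.map g) ≫
        (α_ _ _ _).hom := by
  rw [whiskerLeft_comp, ← Category.assoc, ← cancel_mono (S.u X ◁ (R.mapComp _ _).inv)]
  refine hS.hom_ext ?_
  simp only [Category.assoc, ← whiskerLeft_comp, Iso.hom_inv_id, Category.comp_id]
  rw [tr_map₂, tr_comp_left, tr_un_comp, tr_un, tr_un]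
  calc
    _ = (G.mapComp (f ≫ g) (S.u Z)).hom ▷ S.e _ ⊗≫
        (G.map (f ≫ g) ◁ S.ψ Z ≫ (G.mapComp f g).hom ▷ _) ⊗≫ 𝟙 _ := by
      bicategory
    _ = ((G.mapComp (f ≫ g) (S.u Z)).hom ≫ (G.mapComp f g).hom ▷ _ ≫ (α_ _ _ _).hom) ▷ S.e _ ⊗≫
        G.map f ◁ G.map g ◁ S.ψ Z ⊗≫ 𝟙 _ := by
      rw [whisker_exchange]
      bicategory
    _ = _ := by
      rw [← G.map₂_associator_mapComp]
      bicategory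

/-- The 2-cells of the second triangle. -/
noncomputable def φ (Y : E) : 𝟙 (R.obj Y) ⟶ S.u (R.obj Y) ≫ R.map (S.e Y) :=
  hS.lift ((G.mapId _).hom ▷ S.e Y ≫ (λ_ _).hom)

theorem tr_φ (Y : E) : S.tr (S.e Y) (hS.φ Y) = (G.mapId _).hom ▷ S.e Y ≫ (λ_ _).hom :=
  hS.tr_lift _

/-- Both sides transpose to the counit cell at `f`, up to unit comparisons of `G`. -/
theorem φ_naturality {Y Z : E} (f : Y ⟶ Z) :
    R.map f ◁ hS.φ Z ≫ (α_ _ _ _).inv ≫ hS.un (R.map f) ▷ R.map (S.e Z) ≫ (α_ _ _ _).hom ≫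
      S.u _ ◁ ((R.mapComp _ _).inv ≫ R.map₂ (S.en f) ≫ (R.mapComp _ _).hom) ≫ (α_ _ _ _).inv =
    ((ρ_ _).hom ≫ (λ_ _).inv) ≫ hS.φ Y ▷ R.map f := by
  rw [← cancel_mono ((α_ _ _ _).hom ≫ S.u _ ◁ (R.mapComp _ _).inv)]
  refine hS.hom_ext ?_
  simp only [whiskerLeft_comp, Category.assoc, Iso.inv_hom_id_assoc]
  rw [← whiskerLeft_comp, Iso.hom_inv_id, whiskerLeft_id, Category.comp_id, ← Category.assoc,
    ← Category.assoc, ← Category.assoc, ← Category.assoc, tr_map₂]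
  simp only [Category.assoc]
  rw [tr_un_comp, tr_comp_left, tr_comp_left, tr_comp, tr_φ, tr_φ]
  calc
    _ = ((G.mapComp (R.map f) (𝟙 (R.obj Z))).hom ≫ G.map (R.map f) ◁ (G.mapId _).hom ≫
        (ρ_ _).hom) ▷ S.e Z ⊗≫ S.en f := by
      bicategory
    _ = G.map₂ (ρ_ (R.map f)).hom ▷ S.e Z ⊗≫ (G.map₂ (λ_ (R.map f)).inv ≫
        (G.mapComp (𝟙 (R.obj Y)) (R.map f)).hom ≫ (G.mapId _).hom ▷ _) ▷ S.e Z ⊗≫ S.en f := by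
      rw [G.map₂_leftUnitor_inv_mapComp, G.map₂_right_unitor]
      bicategory
    _ = G.map₂ (ρ_ (R.map f)).hom ▷ S.e Z ⊗≫ G.map₂ (λ_ (R.map f)).inv ▷ S.e Z ⊗≫
        (G.mapComp (𝟙 (R.obj Y)) (R.map f)).hom ▷ S.e Z ⊗≫
        ((G.mapId _).hom ▷ _ ≫ 𝟙 _ ◁ S.en f) ⊗≫ 𝟙 _ := by
      bicategory
    _ = _ := by
      rw [← whisker_exchange]
      bicategory

theorem swallowtail_unit (X : C) :
    (ρ_ (S.u X)).inv ≫ S.u X ◁ hS.φ (G.obj X) ≫ (α_ _ _ _).inv ≫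
      hS.un (S.u X) ▷ R.map (S.e (G.obj X)) ≫ (α_ _ _ _).hom ≫
      S.u X ◁ ((R.mapComp _ _).inv ≫ R.map₂ (S.ψ X) ≫ (R.mapId _).hom) ≫ (ρ_ (S.u X)).hom =
    𝟙 (S.u X) := by
  -- Rewriting the target `u` as `u ≫ R 1` makes transposition available; then both sides transpose
  -- to `ψ X`, the right one by `tr_id`.
  rw [← cancel_mono ((ρ_ (S.u X)).inv ≫ S.u X ◁ (R.mapId _).inv)]
  refine hS.hom_ext ?_
  simp only [whiskerLeft_comp, Category.assoc, Iso.hom_inv_id_assoc, Category.id_comp]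
  rw [← whiskerLeft_comp, Iso.hom_inv_id, whiskerLeft_id, Category.comp_id,
    ← Category.assoc, ← Category.assoc,
    ← Category.assoc, ← Category.assoc, ← Category.assoc, tr_map₂]
  simp only [Category.assoc]
  rw [tr_comp_left, tr_un_comp, tr_id, tr_φ]
  calc
    _ = (G.map₂ (ρ_ (S.u X)).inv ≫ (G.mapComp _ (𝟙 _)).hom ≫ G.map (S.u X) ◁ (G.mapId _).hom) ▷
        S.e _ ⊗≫ S.ψ X := by
      bicategory
    _ = _ := by
      rw [G.map₂_rightUnitor_inv_mapComp]
      bicategory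

/-- The defining equation `tr_φ` of `φ`, with the transpose unfolded. -/
theorem swallowtail_counit (Y : E) :
    (λ_ (S.e Y)).inv ≫ ((G.mapId _).inv ≫ G.map₂ (hS.φ Y) ≫ (G.mapComp _ _).hom) ▷ S.e Y ≫
      (α_ _ _ _).hom ≫ G.map _ ◁ S.en (S.e Y) ≫ (α_ _ _ _).inv ≫
      S.ψ (R.obj Y) ▷ S.e Y ≫ (λ_ (S.e Y)).hom = 𝟙 (S.e Y) := by
  have h := hS.tr_φ Y
  rw [tr, cell] at h
  simp [h]

/-- The defining equation `tr_un` of the unit cells, with the transpose unfolded. -/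
theorem ψ_naturality {X Y : C} (f : X ⟶ Y) :
    ((α_ _ _ _).inv ≫ ((G.mapComp f _).inv ≫ G.map₂ (hS.un f) ≫ (G.mapComp _ _).hom) ▷ S.e _ ≫
      (α_ _ _ _).hom ≫ G.map _ ◁ S.en (G.map f) ≫ (α_ _ _ _).inv) ≫ S.ψ X ▷ G.map f =
    G.map f ◁ S.ψ Y ≫ (ρ_ _).hom ≫ (λ_ _).inv := by
  have h := hS.tr_un f
  rw [tr, cell] at h
  rw [← cancel_mono (λ_ _).hom]
  simp [h]


end IsUniversal

/-- The objectwise data over a given colax natural counit. -/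
def ofCounit (ϵ : ColaxTrans (R.comp G) (Pseudofunctor.id E))
    (u : ∀ X, X ⟶ R.obj (G.obj X))
    (ψ : ∀ X, G.map (u X) ≫ (show G.obj (R.obj (G.obj X)) ⟶ G.obj X from ϵ.app (G.obj X)) ⟶
      𝟙 (G.obj X)) : CounitLifting G R where
  e Y := ϵ.app Y
  en f := ϵ.naturality f
  en_naturality τ := ϵ.naturality_naturality τ
  -- The laws of `ϵ` carry the comparison cells of the identity pseudofunctor, which are identities;
  -- here and in `en_comp` they are inserted by hand.
  en_id Y := (Category.comp_id _).symm.trans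
    ((congrArg (fun x ↦ ϵ.naturality (𝟙 Y) ≫ x) (whiskerLeft_id _ _).symm).trans
      (ϵ.naturality_id Y))
  en_comp f g := (Category.comp_id _).symm.trans
    ((congrArg (fun x ↦ ϵ.naturality (f ≫ g) ≫ x) (whiskerLeft_id _ _).symm).trans
      (ϵ.naturality_comp f g))
  u := u
  ψ := ψ

/-- A universal lifting of a colax natural counit underlies a colax adjunction. -/
noncomputable def colaxAdjunction (ϵ : ColaxTrans (R.comp G) (Pseudofunctor.id E))
    (u : ∀ X, X ⟶ R.obj (G.obj X))
    (ψ : ∀ X, G.map (u X) ≫ (show G.obj (R.obj (G.obj X)) ⟶ G.obj X from ϵ.app (G.obj X)) ⟶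
      𝟙 (G.obj X)) (hS : (ofCounit ϵ u ψ).IsUniversal) : ColaxAdjunction G R where
  unit :=
    { app := u
      naturality f := hS.un f
      naturality_naturality σ := hS.un_naturality σ
      naturality_id X := (hS.un_id X).trans (by
        rw [← Category.id_comp (Iso.hom (λ_ ((ofCounit ϵ u ψ).u X)) ≫ _), ← id_whiskerRight]
        rfl)
      naturality_comp f g := (hS.un_comp f g).trans (by
        rw [← Category.id_comp (Iso.hom (α_ f g _) ≫ _), ← id_whiskerRight]
        rfl) }
  counit := ϵ
  Ψ :=
    { app := ψ
      naturality f := (hS.ψ_naturality f).symm }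
  Φ :=
    { app := hS.φ
      naturality f := hS.φ_naturality f }
  swallowtail_unit := hS.swallowtail_unit
  swallowtail_counit := hS.swallowtail_counit

end CounitLifting

end Lifting

/-! ### Morphisms of free algebras and the multiplication -/

namespace LeftKanPseudomonad

variable {K : Type u} [Bicategory.{w, v} K] (T : LeftKanPseudomonad K)

/-- The 1-cell `h` underlies a morphism of free algebras. -/
def IsHom {A B : K} (h : T.D A ⟶ T.D B) : Prop :=
  ∀ ⦃C : K⦄ (f : C ⟶ T.D A), PreservesLeftKan (T.y C) f (T.ext f) (T.cell f).hom h

variable {T} in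
/-- A morphism of free algebras is a left Kan extension of its restriction along the unit. -/
theorem IsHom.isLeftKan {A B : K} {k : T.D A ⟶ T.D B} (hk : T.IsHom k) :
    IsLeftKan (T.y A) (T.y A ≫ k) k (𝟙 (T.y A ≫ k)) := by
  -- `k` preserves the chosen extension of `y` along `y`, hence also the isomorphic extension `1`.
  have h := PreservesLeftKan.ofIso (hk (T.y A))
    ((T.isLeftKan (T.y A)).iso (T.isLeftKan_id A))
  rw [IsLeftKan.iso_hom, IsLeftKan.fac] at h
  have h' := IsLeftKan.ofIso h (λ_ k) (Iso.refl _)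
  have e : (Iso.refl (T.y A ≫ k)).hom ≫ ((ρ_ (T.y A)).inv ▷ k ≫ (α_ (T.y A) (𝟙 (T.D A)) k).hom) ≫
      T.y A ◁ (λ_ k).hom = 𝟙 _ := by
    simp
  rwa [e] at h'

variable {T} in
theorem IsHom.bijective {A B : K} {k : T.D A ⟶ T.D B} (hk : T.IsHom k) (l : T.D A ⟶ T.D B) :
    Function.Bijective (fun σ : k ⟶ l ↦ T.y A ◁ σ) :=
  ⟨fun _ _ h ↦ hk.isLeftKan.hom_ext (by simpa using h),
    fun τ ↦ ⟨hk.isLeftKan.desc τ, by simpa using hk.isLeftKan.fac τ⟩⟩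

variable {T} in
-- Restriction along `y` is conservative between morphisms: the inverse of the restriction extends
-- because `l` is a morphism, and uniqueness of extensions makes both composites identities.
theorem IsHom.isIso {A B : K} {k l : T.D A ⟶ T.D B} (hk : T.IsHom k) (hl : T.IsHom l)
    (σ : k ⟶ l) [IsIso (T.y A ◁ σ)] : IsIso σ := by
  obtain ⟨τ, hτ : T.y A ◁ τ = inv (T.y A ◁ σ)⟩ := (hl.bijective k).2 (inv (T.y A ◁ σ))
  refine ⟨τ, (hk.bijective k).1 ?_, (hl.bijective l).1 ?_⟩ <;> simp [hτ]

theorem isHom_ext {A B : K} (f : A ⟶ T.D B) : T.IsHom (T.ext f) :=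
  fun _ g ↦ T.preserves g f

theorem isHom_map {A B : K} (f : A ⟶ B) : T.IsHom (T.map f) :=
  T.isHom_ext _

variable {T} in
theorem IsHom.comp {A B C : K} {h : T.D A ⟶ T.D B} {k : T.D B ⟶ T.D C} (hh : T.IsHom h)
    (hk : T.IsHom k) : T.IsHom (h ≫ k) :=
  fun _ f ↦ ((⟨h, @hh⟩ : PsAlg.Hom (T.free A) (T.free B)) ≫
    (⟨k, @hk⟩ : PsAlg.Hom (T.free B) (T.free C)) : T.free A ⟶ T.free C).preserves f

theorem isHom_id (A : K) : T.IsHom (𝟙 (T.D A)) :=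
  fun _ f ↦ .id (T.isLeftKan f)

/-- The multiplication, the extension of the identity. -/
def mul (B : K) : T.D (T.D B) ⟶ T.D B :=
  T.ext (𝟙 (T.D B))

/-- The multiplication is a retraction of the unit. -/
def unitMul (B : K) : T.y (T.D B) ≫ T.mul B ≅ 𝟙 (T.D B) :=
  (T.cell (𝟙 (T.D B))).symm

theorem isHom_mul (B : K) : T.IsHom (T.mul B) :=
  T.isHom_ext _

/-- The restriction of `D g ≫ m` along the unit is `g`. -/
def resMapMul {A B : K} (g : A ⟶ T.D B) : T.y A ≫ T.map g ≫ T.mul B ≅ g :=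
  (α_ _ _ _).symm ≪≫ whiskerRightIso (T.sq g).symm _ ≪≫ α_ _ _ _ ≪≫
    whiskerLeftIso g (T.unitMul B) ≪≫ ρ_ g

theorem resMapMul_naturality {A B : K} {g h : A ⟶ T.D B} (σ : g ⟶ h) :
    T.y A ◁ T.map₂ σ ▷ T.mul B ≫ (T.resMapMul h).hom = (T.resMapMul g).hom ≫ σ := by
  have e : T.y A ◁ T.map₂ σ ≫ (T.sq h).inv = (T.sq g).inv ≫ σ ▷ T.y (T.D B) := by
    rw [Iso.comp_inv_eq, Category.assoc, Iso.eq_inv_comp, sq_map₂]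
  simp only [resMapMul, Iso.trans_hom, Iso.symm_hom, whiskerRightIso_hom, whiskerLeftIso_hom]
  calc
    _ = 𝟙 _ ⊗≫ (T.y A ◁ T.map₂ σ ≫ (T.sq h).inv) ▷ T.mul B ⊗≫
        h ◁ (T.unitMul B).hom ⊗≫ 𝟙 _ := by
      bicategory
    _ = 𝟙 _ ⊗≫ (T.sq g).inv ▷ T.mul B ⊗≫ (σ ▷ _ ≫ h ◁ (T.unitMul B).hom) ⊗≫ 𝟙 _ := by
      rw [e]
      bicategory
    _ = _ := by
      rw [← whisker_exchange]
      bicategory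

/-- The comparison `D y ⟶ y D`. -/
noncomputable def dist (B : K) : T.map (T.y B) ⟶ T.y (T.D B) :=
  (T.isLeftKan_sq (T.y B)).desc (𝟙 _)

theorem unit_dist (B : K) : T.y B ◁ T.dist B = (T.sq (T.y B)).inv := by
  rw [← cancel_epi (T.sq (T.y B)).hom, Iso.hom_inv_id]
  exact IsLeftKan.fac _ _

/-- The target of `dist` is a unit, which need not be a morphism of free algebras. After whiskering
by `mul` and composing with `unitMul`, the 2-cell runs between two morphisms, so invertibility can
be tested along `y`, where `dist` is the inverse of a naturality square. -/
theorem isIso_dist_mul (B : K) : IsIso (T.dist B ▷ T.mul B) := by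
  have e : T.y B ◁ (T.dist B ▷ T.mul B ≫ (T.unitMul B).hom) =
      (α_ _ _ _).inv ≫ (T.sq (T.y B)).inv ▷ T.mul B ≫ (α_ _ _ _).hom ≫
        T.y B ◁ (T.unitMul B).hom := by
    rw [← unit_dist]
    simp
  have : IsIso (T.y B ◁ (T.dist B ▷ T.mul B ≫ (T.unitMul B).hom)) := by
    rw [e]
    infer_instance
  have := ((T.isHom_map (T.y B)).comp (T.isHom_mul B)).isIso (T.isHom_id B)
    (T.dist B ▷ T.mul B ≫ (T.unitMul B).hom)
  exact IsIso.of_isIso_comp_right _ (T.unitMul B).hom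

/-- The counit of the adjunction `D y ⊣ m`, whose whiskering by `m` is invertible. -/
theorem exists_mul_counit (B : K) :
    ∃ κ : T.mul B ≫ T.map (T.y B) ⟶ 𝟙 (T.D (T.D B)), IsIso (κ ▷ T.mul B) := by
  have := T.isIso_dist_mul B
  have hm := (T.isHom_mul B).comp (T.isHom_map (T.y B))
  -- `κ` is prescribed along the unit: contract `y ≫ m` to the identity, then apply `dist`.
  obtain ⟨κ, hκ : _ ◁ κ = _⟩ := (hm.bijective (𝟙 _)).2
    ((α_ _ _ _).inv ≫ (T.unitMul B).hom ▷ T.map (T.y B) ≫ (λ_ _).hom ≫ T.dist B ≫ (ρ_ _).inv)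
  refine ⟨κ, ?_⟩
  have e : T.y (T.D B) ◁ κ ▷ T.mul B = (α_ _ _ _).inv ≫ ((α_ _ _ _).inv ≫
      (T.unitMul B).hom ▷ T.map (T.y B) ≫ (λ_ _).hom) ▷ T.mul B ≫ T.dist B ▷ T.mul B ≫
        (ρ_ _).inv ▷ T.mul B ≫ (α_ _ _ _).hom := by
    have h := congrArg (fun x ↦ (α_ _ _ _).inv ≫ x ▷ T.mul B ≫ (α_ _ _ _).hom) hκ
    simpa using h
  have : IsIso (T.y (T.D B) ◁ κ ▷ T.mul B) := by
    rw [e]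
    infer_instance
  exact (hm.comp (T.isHom_mul B)).isIso ((T.isHom_id _).comp (T.isHom_mul B)) (κ ▷ T.mul B)

/-- Restriction of morphisms of free algebras along the unit. -/
def res (A B : K) : (T.J.obj A ⟶ T.J.obj B) ⥤ (A ⟶ T.D B) where
  obj k := T.y A ≫ k.hom.hom
  map σ := T.y A ◁ σ.hom.cell
  map_id _ := whiskerLeft_id _ _
  map_comp _ _ := whiskerLeft_comp _ _ _

theorem isHom_hom {A B : K} (k : T.J.obj A ⟶ T.J.obj B) :
    T.IsHom (show T.D A ⟶ T.D B from k.hom.hom) :=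
  fun _ f ↦ k.hom.preserves f

instance (A B : K) : (T.res A B).Faithful where
  map_injective {k l σ τ} h := by
    ext
    exact ((T.isHom_hom k).bijective l.hom.hom).1 h

instance (A B : K) : (T.res A B).Full where
  map_surjective {k l} τ := by
    obtain ⟨σ, hσ⟩ := ((T.isHom_hom k).bijective l.hom.hom).2 τ
    exact ⟨⟨⟨σ⟩⟩, hσ⟩

/-- The multiplication as a morphism of free algebras. -/
noncomputable def mult (B : K) : T.J.obj (T.D B) ⟶ T.J.obj B :=
  InducedBicategory.mkHom
    (⟨T.mul B, fun f ↦ T.isHom_mul B f⟩ : PsAlg.Hom (T.free (T.D B)) (T.free B))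

/-- The restriction of `D g ≫ m` along the unit is `g`. -/
noncomputable def resObjMapMult {A B : K} (g : A ⟶ T.D B) :
    (T.res A B).obj (T.J.map g ≫ T.mult B) ≅ g :=
  T.resMapMul g

theorem resObjMapMult_naturality {A B : K} {g h : A ⟶ T.D B} (σ : g ⟶ h) :
    (T.res A B).map (T.J.map₂ σ ▷ T.mult B) ≫ (T.resObjMapMult h).hom =
      (T.resObjMapMult g).hom ≫ σ :=
  T.resMapMul_naturality σ

/-- A morphism of free algebras is determined by its restriction along the unit. -/
noncomputable def mapResMult {A B : K} (k : T.J.obj A ⟶ T.J.obj B) :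
    T.J.map ((T.res A B).obj k) ≫ T.mult B ≅ k :=
  (T.res A B).preimageIso (T.resObjMapMult ((T.res A B).obj k))

theorem mapResMult_naturality {A B : K} {k l : T.J.obj A ⟶ T.J.obj B} (σ : k ⟶ l) :
    T.J.map₂ ((T.res A B).map σ) ▷ T.mult B ≫ (T.mapResMult l).hom =
      (T.mapResMult k).hom ≫ σ := by
  apply (T.res A B).map_injective
  simp only [Functor.map_comp, mapResMult, Functor.preimageIso_hom, Functor.map_preimage,
    resObjMapMult_naturality]

/-- The restriction of `D v` along the unit is `v ≫ y`. -/
noncomputable def resMap {A B : K} (v : A ⟶ B) : (T.res A B).obj (T.J.map v) ≅ v ≫ T.y B :=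
  (T.sq v).symm

theorem exists_mult_counit (B : K) :
    ∃ κ : T.mult B ≫ T.J.map (T.y B) ⟶ 𝟙 (T.J.obj (T.D B)), IsIso (κ ▷ T.mult B) := by
  obtain ⟨κ, ι, h₁, h₂⟩ := T.exists_mul_counit B
  exact ⟨⟨⟨κ⟩⟩, ⟨⟨ι⟩⟩, by ext; exact h₁, by ext; exact h₂⟩

end LeftKanPseudomonad

/-! ### Whiskering by a reflector -/

section Reflection

variable {B : Type u} [Bicategory.{w, v} B]

/-- If `ι` and `ν⁻¹` satisfy the first triangle identity and endomorphisms of `z` are detected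
along `y`, then whiskering by `z` is bijective on 2-cells into 1-cells factoring through `y`. -/
theorem whiskerRight_bijective {a b d : B} {y : b ⟶ d} {z : d ⟶ b} (ν : y ≫ z ≅ 𝟙 b)
    (ι : 𝟙 d ⟶ z ≫ y) (hι : y ◁ ι = (ρ_ y).hom ≫ (λ_ y).inv ≫ ν.inv ▷ y ≫ (α_ _ _ _).hom)
    (hz : ∀ E : z ⟶ z, y ◁ E = 𝟙 _ → E = 𝟙 _) (g : a ⟶ d) (v : a ⟶ b) :
    Function.Bijective (fun σ : g ⟶ v ≫ y ↦ σ ▷ z) := by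
  -- The second triangle identity. Restricted along `y` it follows from the first one, and `hz`
  -- removes the restriction.
  have hE : (λ_ z).inv ≫ ι ▷ z ≫ (α_ _ _ _).hom ≫ z ◁ ν.hom ≫ (ρ_ z).hom = 𝟙 z := by
    apply hz
    calc
      _ = 𝟙 _ ⊗≫ (y ◁ ι) ▷ z ⊗≫ (y ≫ z) ◁ ν.hom ⊗≫ 𝟙 _ := by bicategory
      _ = 𝟙 _ ⊗≫ (ν.inv ▷ (y ≫ z) ≫ (y ≫ z) ◁ ν.hom) ⊗≫ 𝟙 _ := by
        rw [hι]
        bicategory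
      _ = 𝟙 _ ⊗≫ (ν.hom ≫ ν.inv) ⊗≫ 𝟙 _ := by
        rw [← whisker_exchange]
        bicategory
      _ = _ := by
        rw [ν.hom_inv_id]
        bicategory
  -- The two ways of contracting `y ≫ z ≫ y ≫ z` with `ν` agree: they become equal after a further
  -- `ν`, which is invertible.
  have hν : ν.hom ▷ (y ≫ z) ≫ (λ_ _).hom = (y ≫ z) ◁ ν.hom ≫ (ρ_ _).hom := by
    rw [← cancel_mono ν.hom]
    calc
      _ = (ν.hom ▷ (y ≫ z) ≫ 𝟙 b ◁ ν.hom) ⊗≫ 𝟙 _ := by bicategory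
      _ = _ := by
        rw [← whisker_exchange]
        bicategory
  -- The inverse is the adjunct of `τ`: insert `ι`, apply `τ`, then contract with `ν`.
  refine Function.bijective_iff_has_inverse.2 ⟨fun τ ↦ (ρ_ g).inv ≫ g ◁ ι ≫ (α_ _ _ _).inv ≫
    τ ▷ y ≫ (α_ _ _ _).hom ▷ y ≫ (v ◁ ν.hom) ▷ y ≫ (ρ_ v).hom ▷ y, fun σ ↦ ?_, fun τ ↦ ?_⟩
  · calc
      _ = 𝟙 _ ⊗≫ (g ◁ ι ≫ σ ▷ (z ≫ y)) ⊗≫ (v ◁ ν.hom) ▷ y ⊗≫ 𝟙 _ := by bicategory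
      _ = 𝟙 _ ⊗≫ σ ⊗≫ v ◁ (y ◁ ι) ⊗≫ (v ◁ ν.hom) ▷ y ⊗≫ 𝟙 _ := by
        rw [whisker_exchange]
        bicategory
      _ = 𝟙 _ ⊗≫ σ ⊗≫ v ◁ (ν.inv ≫ ν.hom) ▷ y ⊗≫ 𝟙 _ := by
        rw [hι]
        bicategory
      _ = _ := by
        rw [ν.inv_hom_id]
        bicategory
  · calc
      _ = 𝟙 _ ⊗≫ g ◁ ι ▷ z ⊗≫ τ ▷ (y ≫ z) ⊗≫
          v ◁ (ν.hom ▷ (y ≫ z) ≫ (λ_ _).hom) ⊗≫ 𝟙 _ := by bicategory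
      _ = 𝟙 _ ⊗≫ g ◁ ι ▷ z ⊗≫ (τ ▷ (y ≫ z) ≫ ((v ≫ y) ≫ z) ◁ ν.hom) ⊗≫ 𝟙 _ := by
        rw [hν]
        bicategory
      _ = 𝟙 _ ⊗≫ g ◁ ((λ_ z).inv ≫ ι ▷ z ≫ (α_ _ _ _).hom ≫ z ◁ ν.hom ≫ (ρ_ z).hom) ⊗≫
          τ ⊗≫ 𝟙 _ := by
        rw [← whisker_exchange]
        bicategory
      _ = _ := by
        rw [hE]
        bicategory

end Reflection

/-! ### The equivalence of hom-categories given by a biadjunction -/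

namespace ColaxAdjunction

variable {C : Type u₁} [Bicategory.{w₁, v₁} C] {E : Type u₂} [Bicategory.{w₂, v₂} E]
  {F : Pseudofunctor C E} {U : Pseudofunctor E C} (adj : ColaxAdjunction F U)

/-- The 1-cells of the unit. -/
def unitApp (A : C) : A ⟶ U.obj (F.obj A) := adj.unit.app A

/-- The 1-cells of the counit. -/
def counitApp (Y : E) : F.obj (U.obj Y) ⟶ Y := adj.counit.app Y

/-- The 2-cells of the unit. -/
def unitCell {A B : C} (f : A ⟶ B) :
    f ≫ adj.unitApp B ⟶ adj.unitApp A ≫ U.map (F.map f) :=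
  adj.unit.naturality f

/-- The 2-cells of the counit. -/
def counitCell {Y Z : E} (f : Y ⟶ Z) :
    F.map (U.map f) ≫ adj.counitApp Z ⟶ adj.counitApp Y ≫ f :=
  adj.counit.naturality f

theorem unitCell_naturality {A B : C} {f g : A ⟶ B} (σ : f ⟶ g) :
    σ ▷ adj.unitApp B ≫ adj.unitCell g = adj.unitCell f ≫ adj.unitApp A ◁ U.map₂ (F.map₂ σ) :=
  adj.unit.naturality_naturality σ

theorem counitCell_naturality {Y Z : E} {f g : Y ⟶ Z} (σ : f ⟶ g) :
    F.map₂ (U.map₂ σ) ▷ adj.counitApp Z ≫ adj.counitCell g =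
      adj.counitCell f ≫ adj.counitApp Y ◁ σ :=
  adj.counit.naturality_naturality σ

/-- The first triangle 2-cell. -/
def ΨApp (A : C) : F.map (adj.unitApp A) ≫ adj.counitApp (F.obj A) ⟶ 𝟙 (F.obj A) :=
  adj.Ψ.app A

/-- The second triangle 2-cell. -/
def ΦApp (Y : E) : 𝟙 (U.obj Y) ⟶ adj.unitApp (U.obj Y) ≫ U.map (adj.counitApp Y) :=
  adj.Φ.app Y

/-- Transposition of 1-cells out of `F A`. -/
def transpose (A : C) (Y : E) : (F.obj A ⟶ Y) ⥤ (A ⟶ U.obj Y) where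
  obj a := adj.unitApp A ≫ U.map a
  map σ := adj.unitApp A ◁ U.map₂ σ

/-- Transposition of 1-cells into `U Y`. -/
def cotranspose (A : C) (Y : E) : (A ⟶ U.obj Y) ⥤ (F.obj A ⟶ Y) where
  obj v := F.map v ≫ adj.counitApp Y
  map σ := F.map₂ σ ▷ adj.counitApp Y

namespace IsBiadjunction

variable {adj} (hadj : adj.IsBiadjunction)
include hadj

theorem isIso_unitCell {A B : C} (f : A ⟶ B) : IsIso (adj.unitCell f) :=
  hadj.unit_isPseudo f

theorem isIso_counitCell {Y Z : E} (f : Y ⟶ Z) : IsIso (adj.counitCell f) :=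
  hadj.counit_isPseudo f

theorem isIso_ΨApp (A : C) : IsIso (adj.ΨApp A) := hadj.isIso_Ψ A

theorem isIso_ΦApp (Y : E) : IsIso (adj.ΦApp Y) := hadj.isIso_Φ Y

/-- The second triangle 2-cell of a biadjunction is invertible. -/
noncomputable def ΦIso (Y : E) :
    𝟙 (U.obj Y) ≅ (adj.transpose (U.obj Y) Y).obj (adj.counitApp Y) :=
  @asIso _ _ _ _ (adj.ΦApp Y) (hadj.isIso_ΦApp Y)

/-- The 2-cell `η ≫ U (F f ≫ a) ≅ f ≫ η ≫ U a`. -/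
noncomputable def transposeComp {A B : C} {Y : E} (f : A ⟶ B) (a : F.obj B ⟶ Y) :
    (adj.transpose A Y).obj (F.map f ≫ a) ≅ f ≫ (adj.transpose B Y).obj a :=
  have := hadj.isIso_unitCell f
  whiskerLeftIso _ (U.mapComp (F.map f) a) ≪≫ (α_ _ _ _).symm ≪≫
    whiskerRightIso (asIso (adj.unitCell f)).symm _ ≪≫ α_ _ _ _

theorem transposeComp_naturality_left {A B : C} {Y : E} {f g : A ⟶ B} (σ : f ⟶ g)
    (a : F.obj B ⟶ Y) :
    (adj.transpose A Y).map (F.map₂ σ ▷ a) ≫ (hadj.transposeComp g a).hom =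
      (hadj.transposeComp f a).hom ≫ σ ▷ (adj.transpose B Y).obj a := by
  have := hadj.isIso_unitCell f
  have := hadj.isIso_unitCell g
  have h : adj.unitApp A ◁ U.map₂ (F.map₂ σ) ≫ inv (adj.unitCell g) =
      inv (adj.unitCell f) ≫ σ ▷ adj.unitApp B := by
    rw [IsIso.comp_inv_eq, Category.assoc, unitCell_naturality, IsIso.inv_hom_id_assoc]
  simp only [transposeComp, transpose, Iso.trans_hom, Iso.symm_hom, whiskerLeftIso_hom,
    whiskerRightIso_hom, asIso_inv]
  calc
    _ = adj.unitApp A ◁ (U.map₂ (F.map₂ σ ▷ a) ≫ (U.mapComp (F.map g) a).hom) ≫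
        (α_ _ _ _).inv ≫ inv (adj.unitCell g) ▷ U.map a ≫ (α_ _ _ _).hom := by
      simp
    _ = adj.unitApp A ◁ (U.mapComp (F.map f) a).hom ≫ (α_ _ _ _).inv ≫
        (adj.unitApp A ◁ U.map₂ (F.map₂ σ) ≫ inv (adj.unitCell g)) ▷ U.map a ≫
          (α_ _ _ _).hom := by
      rw [U.map₂_whiskerRight_mapComp]
      simp
    _ = _ := by
      rw [h]
      simp

theorem transposeComp_naturality_right {A B : C} {Y : E} (f : A ⟶ B) {a b : F.obj B ⟶ Y}
    (τ : a ⟶ b) :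
    (adj.transpose A Y).map (F.map f ◁ τ) ≫ (hadj.transposeComp f b).hom =
      (hadj.transposeComp f a).hom ≫ f ◁ (adj.transpose B Y).map τ := by
  have := hadj.isIso_unitCell f
  simp only [transposeComp, transpose, Iso.trans_hom, Iso.symm_hom, whiskerLeftIso_hom,
    whiskerRightIso_hom, asIso_inv]
  calc
    _ = adj.unitApp A ◁ (U.map₂ (F.map f ◁ τ) ≫ (U.mapComp (F.map f) b).hom) ≫
        (α_ _ _ _).inv ≫ inv (adj.unitCell f) ▷ U.map b ≫ (α_ _ _ _).hom := by
      simp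
    _ = 𝟙 _ ⊗≫ adj.unitApp A ◁ (U.mapComp (F.map f) a).hom ⊗≫
        ((adj.unitApp A ≫ U.map (F.map f)) ◁ U.map₂ τ ≫ inv (adj.unitCell f) ▷ U.map b) ⊗≫
          𝟙 _ := by
      rw [U.map₂_whiskerLeft_mapComp]
      bicategory
    _ = _ := by
      rw [whisker_exchange]
      bicategory

/-- Transposing back and forth gives the original 1-cell. -/
noncomputable def transposeCotranspose (A : C) (Y : E) :
    adj.cotranspose A Y ⋙ adj.transpose A Y ≅ 𝟭 (A ⟶ U.obj Y) :=
  NatIso.ofComponents (fun v ↦ hadj.transposeComp v _ ≪≫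
    whiskerLeftIso v (hadj.ΦIso Y).symm ≪≫ ρ_ v) (fun {v v'} σ ↦ by
      have h := hadj.transposeComp_naturality_left σ (adj.counitApp Y)
      change (adj.transpose A Y).map (F.map₂ σ ▷ adj.counitApp Y) ≫ (hadj.transposeComp v' _).hom ≫
        v' ◁ (hadj.ΦIso Y).inv ≫ (ρ_ v').hom = ((hadj.transposeComp v _).hom ≫
        v ◁ (hadj.ΦIso Y).inv ≫ (ρ_ v).hom) ≫ σ
      rw [reassoc_of% h]
      rw [← whisker_exchange_assoc, rightUnitor_naturality, Category.assoc, Category.assoc])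

/-- Transposing forth and back gives the original 1-cell. -/
noncomputable def cotransposeTranspose (A : C) (Y : E) :
    adj.transpose A Y ⋙ adj.cotranspose A Y ≅ 𝟭 (F.obj A ⟶ Y) :=
  have := hadj.isIso_ΨApp A
  have (a : F.obj A ⟶ Y) := hadj.isIso_counitCell a
  NatIso.ofComponents (fun a ↦ whiskerRightIso (F.mapComp _ _) _ ≪≫ α_ _ _ _ ≪≫
    whiskerLeftIso _ (asIso (adj.counitCell a)) ≪≫ (α_ _ _ _).symm ≪≫
    whiskerRightIso (asIso (adj.ΨApp A)) a ≪≫ λ_ a) (fun {a b} σ ↦ by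
      change F.map₂ (adj.unitApp A ◁ U.map₂ σ) ▷ adj.counitApp Y ≫
        (F.mapComp (adj.unitApp A) (U.map b)).hom ▷ adj.counitApp Y ≫ (α_ _ _ _).hom ≫
        F.map (adj.unitApp A) ◁ adj.counitCell b ≫ (α_ _ _ _).inv ≫ adj.ΨApp A ▷ b ≫ (λ_ b).hom =
        ((F.mapComp (adj.unitApp A) (U.map a)).hom ▷ adj.counitApp Y ≫ (α_ _ _ _).hom ≫
        F.map (adj.unitApp A) ◁ adj.counitCell a ≫ (α_ _ _ _).inv ≫ adj.ΨApp A ▷ a ≫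
        (λ_ a).hom) ≫ σ
      calc
        _ = (F.map₂ (adj.unitApp A ◁ U.map₂ σ) ≫ (F.mapComp (adj.unitApp A) (U.map b)).hom) ▷
            adj.counitApp Y ⊗≫ F.map (adj.unitApp A) ◁ adj.counitCell b ⊗≫
              adj.ΨApp A ▷ b ⊗≫ 𝟙 _ := by
          bicategory
        _ = (F.mapComp (adj.unitApp A) (U.map a)).hom ▷ adj.counitApp Y ⊗≫
            F.map (adj.unitApp A) ◁ (F.map₂ (U.map₂ σ) ▷ adj.counitApp Y ≫ adj.counitCell b) ⊗≫
              adj.ΨApp A ▷ b ⊗≫ 𝟙 _ := by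
          rw [F.map₂_whiskerLeft_mapComp]
          bicategory
        _ = (F.mapComp (adj.unitApp A) (U.map a)).hom ▷ adj.counitApp Y ⊗≫
            F.map (adj.unitApp A) ◁ adj.counitCell a ⊗≫
              ((F.map (adj.unitApp A) ≫ adj.counitApp _) ◁ σ ≫ adj.ΨApp A ▷ b) ⊗≫ 𝟙 _ := by
          rw [counitCell_naturality]
          bicategory
        _ = _ := by
          rw [whisker_exchange]
          bicategory)

/-- One natural isomorphism comes from `Φ` and the unit cells, the other from `Ψ` and the counit
cells. `Equivalence.mk` adjusts them to satisfy the triangle identity. -/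
theorem isEquivalence_transpose (A : C) (Y : E) : (adj.transpose A Y).IsEquivalence :=
  (CategoryTheory.Equivalence.mk _ _ (hadj.cotransposeTranspose A Y).symm
    (hadj.transposeCotranspose A Y)).isEquivalence_functor

end IsBiadjunction

end ColaxAdjunction

/-! ### Whiskering the images of 2-cells under a pseudofunctor -/

theorem bijective_map₂_whiskerRight_of_iso {C : Type u₁} [Bicategory.{w₁, v₁} C] {E : Type u₂}
    [Bicategory.{w₂, v₂} E] (G : Pseudofunctor C E) {a b : C} {c : E} {k l l' : a ⟶ b}
    (i : l ≅ l') (s : G.obj b ⟶ c)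
    (h : Function.Bijective (fun σ : k ⟶ l' ↦ G.map₂ σ ▷ s)) {f : G.obj a ⟶ c}
    (j : G.map l ≫ s ⟶ f) (hj : IsIso j) :
    Function.Bijective (fun σ : k ⟶ l ↦ G.map₂ σ ▷ s ≫ j) := by
  refine ⟨fun σ τ e ↦ ?_, fun τ ↦ ?_⟩
  · rw [← cancel_mono i.hom]
    apply h.1
    have e' := (cancel_mono j).1 e
    simp [e']
  · obtain ⟨σ, hσ : G.map₂ σ ▷ s = _⟩ := h.2 (τ ≫ inv j ≫ G.map₂ i.hom ▷ s)
    refine ⟨σ ≫ i.inv, ?_⟩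
    have e : G.map₂ i.hom ▷ s ≫ G.map₂ i.inv ▷ s = 𝟙 _ := by
      rw [← comp_whiskerRight, ← G.map₂_comp]
      simp
    simp [reassoc_of% hσ, reassoc_of% e]

theorem map₂_comp_mapComp_whiskerRight {C : Type u₁} [Bicategory.{w₁, v₁} C] {E : Type u₂}
    [Bicategory.{w₂, v₂} E] (G : Pseudofunctor C E) {a b c : C} {d : E} {k l : a ⟶ c}
    {g h : a ⟶ b} {m : b ⟶ c} {σ : k ⟶ l} {i : k ⟶ g ≫ m} {j : l ⟶ h ≫ m} {θ : g ⟶ h}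
    (e : σ ≫ j = i ≫ θ ▷ m) (s : G.obj c ⟶ d) :
    G.map₂ σ ▷ s ≫ (G.map₂ j ≫ (G.mapComp h m).hom) ▷ s ≫ (α_ _ _ _).hom =
      ((G.map₂ i ≫ (G.mapComp g m).hom) ▷ s ≫ (α_ _ _ _).hom) ≫ G.map₂ θ ▷ (G.map m ≫ s) := by
  have e' := congrArg (fun x ↦ G.map₂ x ▷ s ≫ (G.mapComp h m).hom ▷ s ≫ (α_ _ _ _).hom) e
  simpa using e'

/-- Interchange of `G κ` with `τ`: `τ` whiskered by `G (m ≫ n)` is the identity, and this passes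
across `G κ ▷ (G m ≫ s)` to `τ` whiskered by `G 1`. The cell crossed is invertible as soon as `κ ▷
m` is; `κ` itself need not be. -/
theorem eq_id_of_map_whiskerLeft {C : Type u₁} [Bicategory.{w₁, v₁} C] {E : Type u₂}
    [Bicategory.{w₂, v₂} E] (G : Pseudofunctor C E) {a b : C} {d : E} {m : a ⟶ b} {n : b ⟶ a}
    (κ : m ≫ n ⟶ 𝟙 a) (hκ : IsIso (κ ▷ m)) {s : G.obj b ⟶ d} {τ : G.map m ≫ s ⟶ G.map m ≫ s}
    (h : G.map n ◁ τ = 𝟙 _) : τ = 𝟙 _ := by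
  have h₁ : G.map (m ≫ n) ◁ τ = 𝟙 _ := by
    rw [← cancel_mono ((G.mapComp m n).hom ▷ _), whisker_exchange, comp_whiskerLeft, h]
    simp
  have h₂ : IsIso (G.map₂ κ ▷ (G.map m ≫ s)) := by
    have e : G.map₂ κ ▷ (G.map m ≫ s) = (α_ _ _ _).inv ≫ (G.mapComp _ _).inv ▷ s ≫
        G.map₂ (κ ▷ m) ▷ s ≫ (G.mapComp _ _).hom ▷ s ≫ (α_ _ _ _).hom := by
      simp
    rw [e]
    infer_instance
  have h₃ := whisker_exchange (G.map₂ κ) τ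
  rw [h₁, Category.id_comp, ← Category.comp_id (G.map₂ κ ▷ _), Category.assoc, cancel_epi,
    Category.id_comp] at h₃
  have h₄ : 𝟙 (G.obj a) ◁ τ = 𝟙 _ := by
    rw [← cancel_epi ((G.mapId a).hom ▷ _), ← whisker_exchange, ← h₃]
    simp
  simpa using congrArg (fun x ↦ (λ_ _).inv ≫ x ≫ (λ_ _).hom) h₄

theorem isIso_whiskerRight_comp {E : Type u₂} [Bicategory.{w₂, v₂} E] {a b c d : E} {k : a ⟶ c}
    {g : a ⟶ b} {h : b ⟶ c} {s : c ⟶ d} {t : b ⟶ a} {f : a ⟶ d} (μ : k ≅ g ≫ h)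
    (n : h ≫ s ⟶ t ≫ f) (ψ : g ≫ t ⟶ 𝟙 a) (hn : IsIso n) (hψ : IsIso ψ) :
    IsIso (μ.hom ▷ s ≫ (α_ _ _ _).hom ≫ g ◁ n ≫ (α_ _ _ _).inv ≫ ψ ▷ f ≫ (λ_ f).hom) := by
  infer_instance

/-! ### The induced action of `D` on `H Y` -/

namespace ColaxAdjunction.IsBiadjunction

open LeftKanPseudomonad

variable {K : Type u₁} [Bicategory.{w₁, v₁} K] {L : Type u₂} [Bicategory.{w₂, v₂} L]
  {T : LeftKanPseudomonad K} {G : Pseudofunctor T.Kleisli L} {H : Pseudofunctor L K}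
  {adj : ColaxAdjunction (T.J.comp G) H} (hadj : adj.IsBiadjunction)

variable (adj) in
/-- Transposition of 1-cells out of the image of a free algebra. -/
noncomputable def transposeFree (A : K) (Y : L) : (G.obj (T.J.obj A) ⟶ Y) ⥤ (A ⟶ H.obj Y) :=
  adj.transpose A Y

/-- Transposition commutes with precomposition by free morphisms. -/
noncomputable def transposeMap {A B : K} {Y : L} (f : A ⟶ B) (a : G.obj (T.J.obj B) ⟶ Y) :
    (transposeFree adj A Y).obj (G.map (T.J.map f) ≫ a) ≅ f ≫ (transposeFree adj B Y).obj a :=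
  hadj.transposeComp f a

theorem transposeMap_naturality_left {A B : K} {Y : L} {f g : A ⟶ B} (σ : f ⟶ g)
    (a : G.obj (T.J.obj B) ⟶ Y) :
    (transposeFree adj A Y).map (G.map₂ (T.J.map₂ σ) ▷ a) ≫ (hadj.transposeMap g a).hom =
      (hadj.transposeMap f a).hom ≫ σ ▷ (transposeFree adj B Y).obj a :=
  hadj.transposeComp_naturality_left σ a

theorem transposeMap_naturality_right {A B : K} {Y : L} (f : A ⟶ B)
    {a b : G.obj (T.J.obj B) ⟶ Y} (τ : a ⟶ b) :
    (transposeFree adj A Y).map (G.map (T.J.map f) ◁ τ) ≫ (hadj.transposeMap f b).hom =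
      (hadj.transposeMap f a).hom ≫ f ◁ (transposeFree adj B Y).map τ :=
  hadj.transposeComp_naturality_right f τ

include hadj in
theorem full_transposeFree (A : K) (Y : L) : (transposeFree adj A Y).Full :=
  have := hadj.isEquivalence_transpose A Y
  inferInstanceAs (adj.transpose A Y).Full

include hadj in
theorem faithful_transposeFree (A : K) (Y : L) : (transposeFree adj A Y).Faithful :=
  have := hadj.isEquivalence_transpose A Y
  inferInstanceAs (adj.transpose A Y).Faithful

/-- Transposition turns precomposition by a morphism of free algebras into precomposition by its
restriction. -/
noncomputable def transposeHom {A B : K} {Y : L} (k : T.J.obj A ⟶ T.J.obj B)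
    (a : G.obj (T.J.obj B) ⟶ Y) :
    (transposeFree adj A Y).obj (G.map k ≫ a) ≅
      (T.res A B).obj k ≫ (transposeFree adj (T.D B) Y).obj (G.map (T.mult B) ≫ a) :=
  -- An arbitrary `k` is rewritten as `J (res k) ≫ mult`; its free factor can then be pulled out of
  -- the transpose.
  (transposeFree adj A Y).mapIso (whiskerRightIso (G.map₂Iso (T.mapResMult k).symm ≪≫
    G.mapComp _ _) a ≪≫ α_ _ _ _) ≪≫ hadj.transposeMap _ _

theorem transposeHom_naturality {A B : K} {Y : L} {k l : T.J.obj A ⟶ T.J.obj B} (σ : k ⟶ l)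
    (a : G.obj (T.J.obj B) ⟶ Y) :
    (transposeFree adj A Y).map (G.map₂ σ ▷ a) ≫ (hadj.transposeHom l a).hom =
      (hadj.transposeHom k a).hom ≫ (T.res A B).map σ ▷ _ := by
  have h : σ ≫ (T.mapResMult l).inv =
      (T.mapResMult k).inv ≫ T.J.map₂ ((T.res A B).map σ) ▷ T.mult B := by
    rw [Iso.comp_inv_eq, Category.assoc, mapResMult_naturality, Iso.inv_hom_id_assoc]
  simp only [transposeHom, Iso.trans_hom, Functor.mapIso_hom, Category.assoc]
  rw [← transposeMap_naturality_left, ← Functor.map_comp_assoc, ← Functor.map_comp_assoc]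
  exact congrArg (fun x ↦ (transposeFree adj A Y).map x ≫ (hadj.transposeMap _ _).hom)
    (map₂_comp_mapComp_whiskerRight G h a)

variable {Y : L} (s : G.obj (T.J.obj (H.obj Y)) ⟶ Y)

variable (adj) in
/-- The action of `D` on `H Y` induced by a 1-cell `G J H Y ⟶ Y`. -/
noncomputable def action : T.D (H.obj Y) ⟶ H.obj Y :=
  (transposeFree adj (T.D (H.obj Y)) Y).obj (G.map (T.mult _) ≫ s)

variable {s}

/-- Transposition turns `G k ≫ s` into the restriction of `k` followed by the action. -/
noncomputable def transposeHomAction {A : K} (k : T.J.obj A ⟶ T.J.obj (H.obj Y)) :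
    (transposeFree adj A Y).obj (G.map k ≫ s) ≅ (T.res A (H.obj Y)).obj k ≫ action adj s :=
  hadj.transposeHom k s

theorem transposeHomAction_naturality {A : K} {k l : T.J.obj A ⟶ T.J.obj (H.obj Y)} (σ : k ⟶ l) :
    (transposeFree adj A Y).map (G.map₂ σ ▷ s) ≫ (hadj.transposeHomAction l).hom =
      (hadj.transposeHomAction k).hom ≫ (T.res A (H.obj Y)).map σ ▷ action adj s :=
  hadj.transposeHom_naturality σ s

/-- The action is a retraction of the unit. -/
noncomputable def unitAction (i : (transposeFree adj (H.obj Y) Y).obj s ≅ 𝟙 (H.obj Y)) :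
    T.y (H.obj Y) ≫ action adj s ≅ 𝟙 (H.obj Y) :=
  whiskerRightIso (show T.y _ ≅ (T.res _ _).obj (𝟙 (T.J.obj (H.obj Y))) from (ρ_ _).symm) _ ≪≫
    (hadj.transposeHomAction (𝟙 (T.J.obj (H.obj Y)))).symm ≪≫
    (transposeFree adj _ Y).mapIso (whiskerRightIso (G.mapId _) s ≪≫ λ_ _) ≪≫ i

include hadj in
/-- Endomorphisms of the action are detected along the unit. -/
theorem action_hom_ext (E : action adj s ⟶ action adj s)
    (h : T.y (H.obj Y) ◁ E = 𝟙 _) : E = 𝟙 _ := by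
  have := hadj.full_transposeFree
  have := hadj.faithful_transposeFree
  -- Endomorphisms of the action are transposes of endomorphisms `τ` of `G mult ≫ s`, and
  -- restriction along `y` corresponds to whiskering `τ` by `G (J y)`.
  obtain ⟨τ, rfl⟩ := (transposeFree adj _ Y).map_surjective E
  obtain ⟨κ, hκ⟩ := T.exists_mult_counit (H.obj Y)
  rw [eq_id_of_map_whiskerLeft G κ hκ (τ := τ) ?_]
  · exact Functor.map_id _ _
  · apply (transposeFree adj _ Y).map_injective
    have e := hadj.transposeMap_naturality_right (T.y (H.obj Y)) τ
    rw [← cancel_mono (hadj.transposeMap _ _).hom, e, Functor.map_id, Category.id_comp]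
    exact (congrArg (fun x ↦ (hadj.transposeMap _ _).hom ≫ x) h).trans (Category.comp_id _)

include hadj in
-- Through the fully faithful functors `res` and `transposeFree`, the map becomes whiskering by the
-- action on 2-cells into `v ≫ y`, and the action is a reflector with right adjoint `y`.
theorem bijective_map₂_whiskerRight (i : (transposeFree adj (H.obj Y) Y).obj s ≅ 𝟙 (H.obj Y))
    {A : K} (k : T.J.obj A ⟶ T.J.obj (H.obj Y)) (v : A ⟶ H.obj Y) :
    Function.Bijective (fun σ : k ⟶ T.J.map v ↦ G.map₂ σ ▷ s) := by
  have := hadj.full_transposeFree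
  have := hadj.faithful_transposeFree
  -- The unit of the reflection: a 2-cell out of `1` is determined by its restriction along `y`,
  -- here prescribed so that the first triangle identity holds.
  obtain ⟨ι, hι⟩ := ((T.isHom_id (H.obj Y)).bijective (action adj s ≫ T.y _)).2
    ((ρ_ _).hom ≫ (λ_ _).inv ≫ (hadj.unitAction i).inv ▷ T.y _ ≫ (α_ _ _ _).hom)
  have hb := whiskerRight_bijective (hadj.unitAction i) ι hι (fun E ↦ hadj.action_hom_ext E)
    ((T.res A _).obj k) v
  refine ⟨fun σ τ e ↦ ?_, fun τ ↦ ?_⟩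
  · apply (T.res _ _).map_injective
    rw [← cancel_mono (T.resMap v).hom]
    apply hb.1
    have e₁ := hadj.transposeHomAction_naturality (s := s) σ
    have e₂ := hadj.transposeHomAction_naturality (s := s) τ
    change G.map₂ σ ▷ s = G.map₂ τ ▷ s at e
    rw [e, e₂, cancel_epi] at e₁
    simp only [comp_whiskerRight, e₁]
  · obtain ⟨σ', hσ'⟩ := hb.2 ((hadj.transposeHomAction k).inv ≫ (transposeFree adj A Y).map τ ≫
      (hadj.transposeHomAction (T.J.map v)).hom ≫ (T.resMap v).hom ▷ action adj s)
    obtain ⟨σ, hσ⟩ := (T.res _ _).map_surjective (σ' ≫ (T.resMap v).inv)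
    refine ⟨σ, (transposeFree adj A Y).map_injective ?_⟩
    have e : (T.res A _).map σ ▷ action adj s =
        (hadj.transposeHomAction k).inv ≫ (transposeFree adj A Y).map τ ≫
          (hadj.transposeHomAction (T.J.map v)).hom := by
      have e' := congrArg (fun x ↦ x ≫ (T.resMap v).inv ▷ action adj s) hσ'
      simpa [hσ] using e'
    rw [← cancel_mono (hadj.transposeHomAction (T.J.map v)).hom, transposeHomAction_naturality]
    rw [e, Iso.hom_inv_id_assoc]

end ColaxAdjunction.IsBiadjunction

end CategoryTheory

theorem theorem4 {K : Type u₁} [Bicategory.{w₁, v₁} K] [Bicategory.Strict K]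
    {L : Type u₂} [Bicategory.{w₂, v₂} L] [Bicategory.Strict L]
    (T : LeftKanPseudomonad K) (G : Pseudofunctor T.Kleisli L) (H : Pseudofunctor L K)
    (adj : ColaxAdjunction (T.J.comp G) H) (hadj : adj.IsBiadjunction) :
    ∃ adj' : ColaxAdjunction G (H.comp T.J), adj'.counit = adj.counit.reassociate := by
  -- The bijectivity clause is `CounitLifting.IsUniversal` unfolded. It is phrased as an existence
  -- statement because an object of the Kleisli 2-category records only that some generator `A`
  -- exists.
  have key : ∀ X : T.Kleisli, ∃ (u : X ⟶ T.J.obj (H.obj (G.obj X)))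
      (ψ : G.map u ≫ adj.counitApp (G.obj X) ⟶ 𝟙 (G.obj X)),
      ∀ ⦃Y : L⦄ (k : X ⟶ T.J.obj (H.obj Y)) (f : G.obj X ⟶ Y),
        Function.Bijective (fun σ : k ⟶ u ≫ T.J.map (H.map f) ↦ G.map₂ σ ▷ adj.counitApp Y ≫
          (G.mapComp u (T.J.map (H.map f))).hom ▷ adj.counitApp Y ≫ (α_ _ _ _).hom ≫
          G.map u ◁ adj.counitCell f ≫ (α_ _ _ _).inv ≫ ψ ▷ f ≫ (λ_ f).hom) := by
    rintro ⟨_, A, rfl⟩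
    refine ⟨T.J.map (adj.unitApp A), adj.ΨApp A, fun Y k f ↦ ?_⟩
    -- The target `J η ≫ J (H f)` is isomorphic to `J (η ≫ H f)`, so the bijection for `v = η ≫ H f`
    -- applies; the remaining cell into `f` is invertible because `Ψ` and the counit cells are.
    exact bijective_map₂_whiskerRight_of_iso G (T.J.mapComp (adj.unitApp A) (H.map f)).symm
      (adj.counitApp Y) (hadj.bijective_map₂_whiskerRight (hadj.ΦIso Y).symm k _) _
      (isIso_whiskerRight_comp (G.mapComp (T.J.map (adj.unitApp A)) (T.J.map (H.map f)))
        _ _ (hadj.isIso_counitCell f) (hadj.isIso_ΨApp A))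
  choose u ψ hu using key
  exact ⟨CounitLifting.colaxAdjunction adj.counit.reassociate u ψ hu, rfl⟩
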